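/- **Theorem (higher-order Euler–Lagrange equation on an arbitrary time scale).** Let $r\ge 1$ and let $\mathbb T\subset\mathbb R$ be a bounded time scale (a nonempty compact set) with at least $2r+1$ points, $a=\min\mathbb T$, $b=\max\mathbb T$; write $[c,d]_{\mathbb T}=[c,d]\cap\mathbb T$. For a compact time scale $S$ put $\sigma_S(t)=\inf\{s\in S:s>t\}$ and $\rho_S(t)=\sup\{s\in S:s<t\}$ (with $\inf\emptyset=\max S$, $\sup\emptyset=\min S$), $\rho=\rho_{\mathbb T}$, $S^\kappa=S\setminus(\rho_S(\max S),\max S]$, $\mathbb T^{\kappa^0}=\mathbb T$ and $\mathbb T^{\kappa^n}=(\mathbb T^{\kappa^{n-1}})^\kappa=[a,\rho^n(b)]_{\mathbb T}$. The delta derivative at $t\in S^\kappa$ of $f:S\to\mathbb R$ is the number $f^\Delta(t)$, if it exists, such that for every $\varepsilon>0$ one has $|f(\sigma_S(t))-f(s)-f^\Delta(t)(\sigma_S(t)-s)|\le\varepsilon|\sigma_S(t)-s|$ for all $s\in S$ in a neighbourhood of $t$. The function $f^{\Delta^0}=f$ is defined on $\mathbb T$, and $f^{\Delta^{n}}=(f^{\Delta^{n-1}})^\Delta$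 on $\mathbb T^{\kappa^n}$ is the delta derivative of $f^{\Delta^{n-1}}$ on the time scale $\mathbb T^{\kappa^{n-1}}$. A function on $S$ is *rd-continuous at a point* if it is continuous there in case the point is right-dense ($\sigma_S(t)=t$) and has a finite left-sided limit there in case the point is left-dense ($\rho_S(t)=t$). It is *piecewise rd-continuous* if it has finite left-sided limits at left-dense points and finite right-sided limits at right-dense points, and is rd-continuous at all but finitely many points. For $f$ piecewise rd-continuous on $S^\kappa$, $\int_c^d f\,\Delta t=F(d)-F(c)$ ($c,d\in S$), where $F:S\to\mathbb R$ is continuous and $F^\Delta=f$ on $S^\kappa$ except possibly at finitely many right-dense points. Finally, $y\in C^r_{prd}$ means that $y^{\Delta^i}$ exists and is continuous on $\mathbb T^{\kappa^i}$ for $i=0,\dots,r-1$, and that $y^{\Delta^r}$ exists at all but finitely many points of $\mathbb T^{\kappa^r}$ and is piecewise rd-continuous. (The value assigned to $y^{\Delta^r}$ at points where it does not exist is immaterial.) Let $L:[a,\rho^r(b)]_{\mathbb T}\times\mathbb R^{r+1}\to\mathbb R$, $(t,u_0,\dots,u_r)\mapsto L(t,u_0,\dots,u_r)$, be such that the partial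 derivatives $\partial L/\partial u_i$, $i=0,\dots,r$, exist and are continuous on $[a,\rho^r(b)]_{\mathbb T}\times\mathbb R^{r+1}$. Write $[y](t)=(t,y(t),y^\Delta(t),\dots,y^{\Delta^r}(t))$ and $\frac{\partial L}{\partial y^{\Delta^i}}=\frac{\partial L}{\partial u_i}$. Fix real numbers $y_a^i,y_b^i$, $i=0,\dots,r-1$. Call $y\in C^r_{prd}$ *admissible* if $y^{\Delta^i}(a)=y_a^i$ and $y^{\Delta^i}(\rho^{r-1}(b))=y_b^i$ for $i=0,\dots,r-1$, and assume that $t\mapsto L[y](t)$ is piecewise rd-continuous on $[a,\rho^r(b)]_{\mathbb T}$ for every admissible $y$. Let $$\mathcal L(y)=\int_a^{\rho^{r-1}(b)}L[y](t)\,\Delta t ,$$ where this and all integrals below are taken on the time scale $[a,\rho^{r-1}(b)]_{\mathbb T}$. Let $y$ be a *weak local minimizer*: $y$ is admissible and there is $\delta>0$ with $\mathcal L(y)\le\mathcal L(\bar y)$ for all admissible $\bar y$ with $\sum_{i=0}^r\sup_{t\in[a,\rho^r(b)]_{\mathbb T}}|(y-\bar y)^{\Delta^i}(t)|<\delta$.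 Let $\sigma$ be the forward jump operator of $[a,\rho^{r-1}(b)]_{\mathbb T}$. For a function $f$ put $I^0f=f$, $(I^kf)(t)=\int_a^{\sigma(t)}(I^{k-1}f)(\tau)\,\Delta\tau$. Then there are constants $c_1,\dots,c_r\in\mathbb R$ such that, with $N_0=\frac{\partial L}{\partial y}[y]$ and $N_k(t)=\int_a^{\sigma(t)}N_{k-1}(\tau)\,\Delta\tau-(-1)^kc_k$ for $k=1,\dots,r$, $$\frac{\partial L}{\partial y^{\Delta^r}}[y](t)+\sum_{k=1}^{r-1}(-1)^k\Big(I^k\tfrac{\partial L}{\partial y^{\Delta^{r-k}}}[y]\Big)(t)+(-1)^rN_r(t)=0$$ for all $t\in[a,\rho^r(b)]_{\mathbb T}$ at which $y^{\Delta^r}(t)$ exists. No restriction is imposed on the forward jump operator. -/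

import Mathlib

open Set Filter Topology
open scoped ENNReal

noncomputable section

namespace TimeScale

open scoped Classical in
/-- The forward jump operator `σ(t) = inf {s ∈ T : s > t}`, with `inf ∅ = sup T`. -/
def sigma (T : Set ℝ) (t : ℝ) : ℝ :=
  if {s ∈ T | t < s}.Nonempty then sInf {s ∈ T | t < s} else sSup T

open scoped Classical in
/-- The backward jump operator `ρ(t) = sup {s ∈ T : s < t}`, with `sup ∅ = inf T`. -/
def rho (T : Set ℝ) (t : ℝ) : ℝ :=
  if {s ∈ T | s < t}.Nonempty then sSup {s ∈ T | s < t} else sInf T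

/-- `T^κ = T \ (ρ(b), b]` where `b = max T`. -/
def kappa (T : Set ℝ) : Set ℝ :=
  T \ Ioc (rho T (sSup T)) (sSup T)

/-- `T^{κ^n}`.  For a bounded time scale this is `[a, ρ^n(b)] ∩ T`; it is again a time scale. -/
def kappaIter (T : Set ℝ) (n : ℕ) : Set ℝ := kappa^[n] T

/-- `f'` is a delta derivative of `f` (a function on the time scale `T`) at the point `t`. -/
def HasDeltaDerivAt (T : Set ℝ) (f : ℝ → ℝ) (f' t : ℝ) : Prop :=
  ∀ ε > 0, ∃ U ∈ 𝓝 t, ∀ s ∈ U ∩ T,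
    |f (sigma T t) - f s - f' * (sigma T t - s)| ≤ ε * |sigma T t - s|

/-- `f` is delta differentiable at `t`. -/
def DeltaDifferentiableAt (T : Set ℝ) (f : ℝ → ℝ) (t : ℝ) : Prop :=
  ∃ f', HasDeltaDerivAt T f f' t

open scoped Classical in
/-- The delta derivative `f^Δ` (with the value `0` where `f` is not delta differentiable). -/
def deltaDeriv (T : Set ℝ) (f : ℝ → ℝ) (t : ℝ) : ℝ :=
  if h : DeltaDifferentiableAt T f t then h.choose else 0

/-- The iterated delta derivative `f^{Δ^n}`, a function on `T^{κ^n}`: the function `f^{Δ^n}`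
lives on the time scale `T^{κ^n}` and is differentiated there. -/
def iterDeltaDeriv (T : Set ℝ) : ℕ → (ℝ → ℝ) → ℝ → ℝ
  | 0, f => f
  | n + 1, f => deltaDeriv (kappaIter T n) (iterDeltaDeriv T n f)

/-- rd-continuity at a point: continuity if `t` is right-dense, existence of a finite left-sided
limit if `t` is left-dense. -/
def RdContinuousAt (T : Set ℝ) (f : ℝ → ℝ) (t : ℝ) : Prop :=
  (sigma T t = t → ContinuousWithinAt f T t) ∧
  (rho T t = t → ∃ l : ℝ, Tendsto f (𝓝[T ∩ Iio t] t) (𝓝 l))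

/-- Regulated functions: finite left-sided limits at left-dense points and finite right-sided
limits at right-dense points.  (At the other points the filters below are trivial.) -/
def Regulated (T : Set ℝ) (f : ℝ → ℝ) : Prop :=
  ∀ t ∈ T, (∃ l : ℝ, Tendsto f (𝓝[T ∩ Iio t] t) (𝓝 l)) ∧
    (∃ l : ℝ, Tendsto f (𝓝[T ∩ Ioi t] t) (𝓝 l))

/-- Piecewise rd-continuity: regulated, and rd-continuous at all but finitely many points. -/
def PiecewiseRdContinuous (T : Set ℝ) (f : ℝ → ℝ) : Prop :=
  Regulated T f ∧ {t ∈ T | ¬ RdContinuousAt T f t}.Finite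

/-- The class `C_prd^r` (for `r ≥ 1`): `y^{Δ^i}` exists on `T^{κ^i}` and is continuous for
`i = 0, …, r-1`, and `y^{Δ^r}` exists at all but finitely many points of `T^{κ^r}` and is
piecewise rd-continuous. -/
structure Cprd (T : Set ℝ) (r : ℕ) (y : ℝ → ℝ) : Prop where
  exists_deriv : ∀ i, i + 1 < r → ∀ t ∈ kappaIter T (i + 1),
    DeltaDifferentiableAt (kappaIter T i) (iterDeltaDeriv T i y) t
  continuousOn : ∀ i < r, ContinuousOn (iterDeltaDeriv T i y) (kappaIter T i)
  exists_top : {t ∈ kappaIter T r |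
    ¬ DeltaDifferentiableAt (kappaIter T (r - 1)) (iterDeltaDeriv T (r - 1) y) t}.Finite
  piecewise_top : PiecewiseRdContinuous (kappaIter T r) (iterDeltaDeriv T r y)

/-- `F` is an antiderivative of the (piecewise rd-continuous) function `f : T^κ → ℝ`: `F` is
continuous on `T`, and `F^Δ(t) = f(t)` for all `t ∈ T^κ` except possibly at finitely many
right-dense points. -/
def IsDeltaAntideriv (T : Set ℝ) (f F : ℝ → ℝ) : Prop :=
  ContinuousOn F T ∧ ∃ D : Set ℝ, D.Finite ∧ (∀ t ∈ D, sigma T t = t) ∧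
    ∀ t ∈ kappa T \ D, HasDeltaDerivAt T F (f t) t

open scoped Classical in
/-- The delta integral `∫_c^d f(t) Δt = F(d) - F(c)`, `F` an antiderivative of `f` on `T`. -/
def deltaIntegral (T : Set ℝ) (f : ℝ → ℝ) (c d : ℝ) : ℝ :=
  if h : ∃ F, IsDeltaAntideriv T f F then h.choose d - h.choose c else 0

/-- The vector `(y(t), y^Δ(t), …, y^{Δ^r}(t))`. -/
def jet (T : Set ℝ) (r : ℕ) (y : ℝ → ℝ) (t : ℝ) : Fin (r + 1) → ℝ :=
  fun i => iterDeltaDeriv T i y t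

/-- The partial derivative of `(t, u) ↦ L t u` with respect to the coordinate `u_i`. -/
def partialDeriv {n : ℕ} (L : ℝ → (Fin n → ℝ) → ℝ) (i : Fin n) (t : ℝ) (u : Fin n → ℝ) : ℝ :=
  deriv (fun s => L t (Function.update u i s)) (u i)

/-- All partial derivatives `∂L/∂u_i` exist on `S × ℝ^n` and are continuous there, as functions
of `(t, u)`. -/
def HasContinuousPartials {n : ℕ} (S : Set ℝ) (L : ℝ → (Fin n → ℝ) → ℝ) : Prop :=
  ∀ i : Fin n,
    (∀ t ∈ S, ∀ u : Fin n → ℝ,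
      DifferentiableAt ℝ (fun s => L t (Function.update u i s)) (u i)) ∧
    ContinuousOn (fun p : ℝ × (Fin n → ℝ) => partialDeriv L i p.1 p.2) (S ×ˢ univ)

/-- `y ∈ C_prd^r` satisfies the boundary conditions `y^{Δ^i}(a) = ya i` and
`y^{Δ^i}(ρ^{r-1}(b)) = yb i`, `i = 0, …, r-1`. -/
def Admissible (T : Set ℝ) (r : ℕ) (ya yb : Fin r → ℝ) (y : ℝ → ℝ) : Prop :=
  Cprd T r y ∧ ∀ i : Fin r, iterDeltaDeriv T i y (sInf T) = ya i ∧
    iterDeltaDeriv T i y ((rho T)^[r - 1] (sSup T)) = yb i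

/-- The functional `∫_a^{ρ^{r-1}(b)} L(t, y(t), …, y^{Δ^r}(t)) Δt`.  Its integrand is a function on
`T^{κ^r}`, and the integral is taken on the time scale `T^{κ^{r-1}} = [a, ρ^{r-1}(b)] ∩ T`. -/
def functional (T : Set ℝ) (r : ℕ) (L : ℝ → (Fin (r + 1) → ℝ) → ℝ) (y : ℝ → ℝ) : ℝ :=
  deltaIntegral (kappaIter T (r - 1)) (fun t => L t (jet T r y t))
    (sInf T) ((rho T)^[r - 1] (sSup T))

/-- `‖y‖_{r,∞} = ∑_{i=0}^r sup_{t ∈ [a, ρ^r(b)]_T} |y^{Δ^i}(t)|`, as an extended real. -/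
def weakNorm (T : Set ℝ) (r : ℕ) (y : ℝ → ℝ) : ℝ≥0∞ :=
  ∑ i ∈ Finset.range (r + 1), ⨆ t ∈ kappaIter T r, ENNReal.ofReal |iterDeltaDeriv T i y t|

/-- Weak local minimizers of the functional under the boundary conditions. -/
def IsWeakLocalMinimizer (T : Set ℝ) (r : ℕ) (L : ℝ → (Fin (r + 1) → ℝ) → ℝ)
    (ya yb : Fin r → ℝ) (y : ℝ → ℝ) : Prop :=
  Admissible T r ya yb y ∧ ∃ δ : ℝ, 0 < δ ∧ ∀ z : ℝ → ℝ, Admissible T r ya yb z →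
    weakNorm T r (fun t => y t - z t) < ENNReal.ofReal δ →
    functional T r L y ≤ functional T r L z

/-- The `k`-fold iterated integral
`∫_a^{σ(t)} ∫_a^{σ(τ_k)} ⋯ ∫_a^{σ(τ_2)} f(τ_1) Δτ_1 ⋯ Δτ_k`, with `a = min T`. -/
def iterIntegral (T : Set ℝ) (f : ℝ → ℝ) : ℕ → ℝ → ℝ
  | 0 => f
  | k + 1 => fun t => deltaIntegral T (iterIntegral T f k) (sInf T) (sigma T t)

/-- The `k`-fold iterated integral with a constant of integration added at each step,
`N_0 = f` and `N_k(t) = ∫_a^{σ(t)} N_{k-1}(τ) Δτ - (-1)^k c_k`; thus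
`N_1(t) = ∫_a^{σ(t)} f(τ) Δτ + c_1`. -/
def iterIntegralConst (T : Set ℝ) (f : ℝ → ℝ) (c : ℕ → ℝ) : ℕ → ℝ → ℝ
  | 0 => f
  | k + 1 => fun t =>
      deltaIntegral T (iterIntegralConst T f c k) (sInf T) (sigma T t) - (-1) ^ (k + 1) * c (k + 1)

/-- `∂L/∂y^{Δ^i}[y](t)`, the partial derivative with respect to the argument occupied by
`y^{Δ^i}`, along `y`. -/
def partialAlong (T : Set ℝ) (r : ℕ) (L : ℝ → (Fin (r + 1) → ℝ) → ℝ) (y : ℝ → ℝ)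
    (i : Fin (r + 1)) (t : ℝ) : ℝ :=
  partialDeriv L i t (jet T r y t)

/-- The left-hand side of the Euler–Lagrange equation,
`L_{y^{Δ^r}}[y](t) + ∑_{k=1}^{r-1} (-1)^k I^k(L_{y^{Δ^{r-k}}}[y])(t) + (-1)^r N_r(t)`,
with `I^k` the iterated integrals and `N_r` the iterated integral of `L_y[y]` with the
constants `c_1, …, c_r`, both on the time scale `[a, ρ^{r-1}(b)] ∩ T`. -/
def eulerLagrange (T : Set ℝ) (r : ℕ) (L : ℝ → (Fin (r + 1) → ℝ) → ℝ) (y : ℝ → ℝ)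
    (c : ℕ → ℝ) (t : ℝ) : ℝ :=
  partialAlong T r L y (Fin.last r) t
    + ∑ k ∈ Finset.Ico 1 r, (-1) ^ k *
        iterIntegral (kappaIter T (r - 1))
          (partialAlong T r L y ⟨r - k, Nat.lt_succ_of_le (Nat.sub_le r k)⟩) k t
    + (-1) ^ r * iterIntegralConst (kappaIter T (r - 1)) (partialAlong T r L y 0) c r t

end TimeScale

end

/-!
Higher-order Euler–Lagrange equation on a compact time scale `T`.

Write `S = T^{κ^{r-1}}`, with minimum `a` and maximum `B`.  Extending a function on `S` to `[a, B]`
as a constant on every gap of `S` turns the delta integral into a Lebesgue integral (`primitive`,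
`deltaIntegral_eq`); this uses that a continuous function whose delta derivative vanishes off
finitely many right-dense points is constant (`eq_of_hasDeltaDerivAt_zero`).  Dominated convergence
then differentiates the functional under the integral sign (`hasDerivAt_primitive_line`).

A variation is determined by its top derivative `w`: the lower derivatives are the iterated
primitives of `w` on `S`, and if all of them vanish at `B` the function can be continued by zero to
the remaining points of `T` (`exists_deltaJet_variation`).  Minimality and repeated integration by
parts (`PrdOn.primitive_mul_iterate`) give `∫ G w Δt = 0` for every such `w`, where `G` is the
Euler–Lagrange expression without its constants of integration.

Also by repeated integration by parts, the iterated primitives of `w` vanish at `B` as soon as `w`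
is orthogonal to the iterated integrals `p_0, …, p_{r-1}` of the constant function `1`
(`PrdOn.iterate_primitive_sSup`).  Hence `w = G - ∑ d_j p_j`, with `∑ d_j p_j` the orthogonal
projection of `G` to the span of the `p_j`, is itself the top derivative of a variation, and
`∫ w² Δt = ∫ G w Δt - ∑ d_j ∫ p_j w Δt = 0`.  So `w` vanishes at right-scattered points and at
right-dense points where it is continuous (`PrdOn.eq_zero_of_primitive_sq`), and it is continuous at
the right-dense points where `y^{Δ^r}` exists, because there the one-sided limits of `y^{Δ^r}` equal
the derivative (`Cprd.continuousWithinAt_top`).  The coefficients `d_j` are, up to sign, the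
constants `c_k` (`eulerLagrange_eq`).
-/

noncomputable section

namespace TimeScale

open MeasureTheory Asymptotics

/-! ### Jump operators and one-sided neighbourhoods -/

lemma sigma_mem {S : Set ℝ} (hS : IsCompact S) (hne : S.Nonempty) (t : ℝ) : sigma S t ∈ S := by
  unfold sigma
  split_ifs with h
  · have hcl : sInf {s ∈ S | t < s} ∈ closure {s ∈ S | t < s} :=
      csInf_mem_closure h (hS.bddBelow.mono (sep_subset _ _))
    exact closure_minimal (sep_subset _ _) hS.isClosed hcl
  · exact hS.sSup_mem hne

lemma le_sigma {S : Set ℝ} {t : ℝ} (ht : t ≤ sSup S) : t ≤ sigma S t := by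
  unfold sigma
  split_ifs with h
  · exact le_csInf h fun s hs => hs.2.le
  · exact ht

lemma sigma_le {S : Set ℝ} (hS : IsCompact S) {t s : ℝ} (hs : s ∈ S) (hts : t < s) :
    sigma S t ≤ s := by
  have h : {s ∈ S | t < s}.Nonempty := ⟨s, hs, hts⟩
  rw [sigma, if_pos h]
  exact csInf_le (hS.bddBelow.mono (sep_subset _ _)) ⟨hs, hts⟩

lemma sigma_sSup {S : Set ℝ} (hS : IsCompact S) : sigma S (sSup S) = sSup S := by
  rw [sigma, if_neg]
  rintro ⟨s, hs, hlt⟩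
  exact absurd (le_csSup hS.bddAbove hs) (not_le.2 hlt)

lemma rho_mem {S : Set ℝ} (hS : IsCompact S) (hne : S.Nonempty) (t : ℝ) : rho S t ∈ S := by
  unfold rho
  split_ifs with h
  · have hcl : sSup {s ∈ S | s < t} ∈ closure {s ∈ S | s < t} :=
      csSup_mem_closure h (hS.bddAbove.mono (sep_subset _ _))
    exact closure_minimal (sep_subset _ _) hS.isClosed hcl
  · exact hS.sInf_mem hne

lemma rho_le {S : Set ℝ} {t : ℝ} (ht : sInf S ≤ t) : rho S t ≤ t := by
  unfold rho
  split_ifs with h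
  · exact csSup_le h fun s hs => hs.2.le
  · exact ht

lemma le_rho {S : Set ℝ} (hS : IsCompact S) {t s : ℝ} (hs : s ∈ S) (hst : s < t) :
    s ≤ rho S t := by
  have h : {s ∈ S | s < t}.Nonempty := ⟨s, hs, hst⟩
  rw [rho, if_pos h]
  exact le_csSup (hS.bddAbove.mono (sep_subset _ _)) ⟨hs, hst⟩

/-- At a right-dense point other than the maximum the points of `S` accumulate from the right. -/
lemma exists_mem_Ioo_of_sigma_eq {S : Set ℝ} (hS : IsCompact S) {t : ℝ} (hne : S.Nonempty)
    (ht : t < sSup S) (h : sigma S t = t) {u : ℝ} (hu : t < u) : ∃ s ∈ S, t < s ∧ s < u := by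
  have hne' : {s ∈ S | t < s}.Nonempty := ⟨sSup S, hS.sSup_mem hne, ht⟩
  rw [sigma, if_pos hne'] at h
  obtain ⟨s, hs, hsu⟩ := exists_lt_of_csInf_lt hne' (h.trans_lt hu)
  exact ⟨s, hs.1, hs.2, hsu⟩

lemma neBot_right_iff {S : Set ℝ} {t : ℝ} :
    (𝓝[S ∩ Ioi t] t).NeBot ↔ ∀ u, t < u → ∃ s ∈ S, t < s ∧ s < u := by
  constructor
  · intro h u hu
    have : ∀ᶠ s in 𝓝[S ∩ Ioi t] t, s < u := nhdsWithin_le_nhds (Iio_mem_nhds hu)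
    obtain ⟨s, hs, hsu⟩ := (this.and self_mem_nhdsWithin).exists
    exact ⟨s, hsu.1, hsu.2, hs⟩
  · intro h
    rw [← mem_closure_iff_nhdsWithin_neBot, Metric.mem_closure_iff]
    intro ε hε
    obtain ⟨s, hs, h1, h2⟩ := h (t + ε) (by linarith)
    refine ⟨s, ⟨hs, h1⟩, ?_⟩
    rw [dist_comm, Real.dist_eq, abs_of_pos (by linarith)]
    linarith

lemma neBot_left_iff {S : Set ℝ} {t : ℝ} :
    (𝓝[S ∩ Iio t] t).NeBot ↔ ∀ u, u < t → ∃ s ∈ S, u < s ∧ s < t := by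
  constructor
  · intro h u hu
    have : ∀ᶠ s in 𝓝[S ∩ Iio t] t, u < s := nhdsWithin_le_nhds (Ioi_mem_nhds hu)
    obtain ⟨s, hs, hsu⟩ := (this.and self_mem_nhdsWithin).exists
    exact ⟨s, hsu.1, hs, hsu.2⟩
  · intro h
    rw [← mem_closure_iff_nhdsWithin_neBot, Metric.mem_closure_iff]
    intro ε hε
    obtain ⟨s, hs, h1, h2⟩ := h (t - ε) (by linarith)
    refine ⟨s, ⟨hs, h2⟩, ?_⟩
    rw [Real.dist_eq, abs_of_pos (by linarith)]
    linarith

lemma neBot_right_of_sigma_eq {S : Set ℝ} (hS : IsCompact S) (hne : S.Nonempty) {t : ℝ}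
    (ht : t < sSup S) (h : sigma S t = t) : (𝓝[S ∩ Ioi t] t).NeBot :=
  neBot_right_iff.2 fun _ hu => exists_mem_Ioo_of_sigma_eq hS hne ht h hu

lemma sigma_eq_of_neBot_right {S : Set ℝ} (hS : IsCompact S) {t : ℝ} (ht : t ∈ S)
    (h : (𝓝[S ∩ Ioi t] t).NeBot) : sigma S t = t := by
  refine le_antisymm (le_of_forall_gt_imp_ge_of_dense fun u hu => ?_)
    (le_sigma (le_csSup hS.bddAbove ht))
  obtain ⟨s, hs, h1, h2⟩ := neBot_right_iff.1 h u hu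
  exact (sigma_le hS hs h1).trans h2.le

/-- A neighbourhood of a point of `S` splits into its left part, the point, and its right part. -/
lemma nhdsWithin_eq_left_sup_right {S : Set ℝ} {t : ℝ} (ht : t ∈ S) :
    𝓝[S] t = 𝓝[S ∩ Iio t] t ⊔ pure t ⊔ 𝓝[S ∩ Ioi t] t := by
  have : S = (S ∩ Iio t ∪ {t}) ∪ S ∩ Ioi t := by
    ext s
    simp only [mem_union, mem_inter_iff, mem_Iio, mem_singleton_iff, mem_Ioi]
    constructor
    · intro hs
      rcases lt_trichotomy s t with h | h | h <;> tauto
    · rintro ((h | h) | h)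
      · exact h.1
      · exact h ▸ ht
      · exact h.1
  conv_lhs => rw [this]
  rw [nhdsWithin_union, nhdsWithin_union, nhdsWithin_singleton]

lemma continuousWithinAt_iff_left_right {S : Set ℝ} {t : ℝ} (ht : t ∈ S) {f : ℝ → ℝ} :
    ContinuousWithinAt f S t ↔
      Tendsto f (𝓝[S ∩ Iio t] t) (𝓝 (f t)) ∧ Tendsto f (𝓝[S ∩ Ioi t] t) (𝓝 (f t)) := by
  rw [ContinuousWithinAt, nhdsWithin_eq_left_sup_right ht, tendsto_sup, tendsto_sup]
  exact ⟨fun h => ⟨h.1.1, h.2⟩, fun h => ⟨⟨h.1, tendsto_pure_nhds _ _⟩, h.2⟩⟩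

lemma tendsto_sigma_left {S : Set ℝ} (hS : IsCompact S) (hne : S.Nonempty) {t : ℝ} (ht : t ∈ S) :
    Tendsto (sigma S) (𝓝[S ∩ Iio t] t) (𝓝[S] t) := by
  refine tendsto_nhdsWithin_iff.2 ⟨?_, Eventually.of_forall fun s => sigma_mem hS hne s⟩
  have hid : Tendsto (fun s : ℝ => s) (𝓝[S ∩ Iio t] t) (𝓝 t) := nhdsWithin_le_nhds
  refine tendsto_of_tendsto_of_tendsto_of_le_of_le' hid tendsto_const_nhds ?_ ?_
  · filter_upwards [self_mem_nhdsWithin] with s hs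
    exact le_sigma (le_csSup hS.bddAbove hs.1)
  · filter_upwards [self_mem_nhdsWithin] with s hs
    exact sigma_le hS ht hs.2

lemma tendsto_sigma_right {S : Set ℝ} (hS : IsCompact S) (hne : S.Nonempty) {t : ℝ} :
    Tendsto (sigma S) (𝓝[S ∩ Ioi t] t) (𝓝[S] t) := by
  refine tendsto_nhdsWithin_iff.2 ⟨?_, Eventually.of_forall fun s => sigma_mem hS hne s⟩
  refine tendsto_order.2 ⟨fun u hu => ?_, fun u hu => ?_⟩
  · filter_upwards [self_mem_nhdsWithin] with s hs
    exact (hu.trans hs.2).trans_le (le_sigma (le_csSup hS.bddAbove hs.1))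
  · by_cases h : ∃ s ∈ S, t < s ∧ s < u
    · obtain ⟨s₁, hs₁, h1, h2⟩ := h
      filter_upwards [nhdsWithin_le_nhds (Iio_mem_nhds h1)] with s hs
      exact (sigma_le hS hs₁ hs).trans_lt h2
    · filter_upwards [self_mem_nhdsWithin, nhdsWithin_le_nhds (Iio_mem_nhds hu)] with s hs hsu
      exact absurd ⟨s, hs.1, hs.2, hsu⟩ h

/-! ### Delta derivatives -/

lemma hasDeltaDerivAt_iff_isLittleO {T : Set ℝ} {f : ℝ → ℝ} {d t : ℝ} :
    HasDeltaDerivAt T f d t ↔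
      (fun s => f (sigma T t) - f s - d * (sigma T t - s)) =o[𝓝[T] t]
        (fun s => sigma T t - s) := by
  simp only [HasDeltaDerivAt, isLittleO_iff, Real.norm_eq_abs]
  refine forall₂_congr fun ε _ => ?_
  rw [eventually_iff, mem_nhdsWithin_iff_exists_mem_nhds_inter]
  rfl

/-- At a right-dense point the delta derivative is the ordinary derivative within the time
scale. -/
lemma hasDeltaDerivAt_iff_of_sigma_eq {T : Set ℝ} {f : ℝ → ℝ} {d t : ℝ} (h : sigma T t = t) :
    HasDeltaDerivAt T f d t ↔ HasDerivWithinAt f d T t := by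
  rw [hasDeltaDerivAt_iff_isLittleO, h, hasDerivWithinAt_iff_isLittleO]
  rw [← isLittleO_neg_left, ← isLittleO_neg_right]
  refine isLittleO_congr (Eventually.of_forall fun s => ?_) (Eventually.of_forall fun s => ?_)
  · simp only [smul_eq_mul]; ring
  · ring

/-- At a right-scattered point the delta derivative is a difference quotient. -/
lemma hasDeltaDerivAt_of_lt_sigma {T : Set ℝ} {f : ℝ → ℝ} {d t : ℝ} (h : t < sigma T t)
    (hf : ContinuousWithinAt f T t) (hd : f (sigma T t) - f t = d * (sigma T t - t)) :
    HasDeltaDerivAt T f d t := by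
  rw [hasDeltaDerivAt_iff_isLittleO]
  have hid : Tendsto (fun s : ℝ => s) (𝓝[T] t) (𝓝 t) := nhdsWithin_le_nhds
  have h1 : Tendsto (fun s => f (sigma T t) - f s - d * (sigma T t - s)) (𝓝[T] t) (𝓝 0) := by
    have := (tendsto_const_nhds (x := f (sigma T t))).sub hf |>.sub
      ((tendsto_const_nhds (x := d)).mul ((tendsto_const_nhds (x := sigma T t)).sub hid))
    rwa [hd, sub_self] at this
  have h2 : (fun _ : ℝ => (1 : ℝ)) =O[𝓝[T] t] (fun s => sigma T t - s) := by
    refine isBigO_const_left_iff_pos_le_norm one_ne_zero |>.2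
      ⟨(sigma T t - t) / 2, by linarith, ?_⟩
    have : ∀ᶠ s in 𝓝[T] t, s < (sigma T t + t) / 2 := hid.eventually_lt_const (by linarith)
    filter_upwards [this] with s hs
    rw [Real.norm_eq_abs]
    exact le_trans (by linarith) (le_abs_self _)
  exact ((isLittleO_one_iff ℝ).2 h1).trans_isBigO h2

lemma HasDeltaDerivAt.sub_eq {T : Set ℝ} {f : ℝ → ℝ} {d t : ℝ} (h : HasDeltaDerivAt T f d t)
    (ht : t ∈ T) : f (sigma T t) - f t = d * (sigma T t - t) := by
  rw [hasDeltaDerivAt_iff_isLittleO] at h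
  have : ∀ ε > 0, |f (sigma T t) - f t - d * (sigma T t - t)| ≤ ε * |sigma T t - t| := by
    intro ε hε
    exact (isLittleO_iff.1 h hε).self_of_nhdsWithin ht
  have h0 : |f (sigma T t) - f t - d * (sigma T t - t)| ≤ 0 := by
    refine le_of_forall_pos_le_add fun ε hε => ?_
    have h1 := this (ε / (|sigma T t - t| + 1)) (by positivity)
    refine h1.trans ?_
    rw [zero_add, div_mul_eq_mul_div, div_le_iff₀ (by positivity)]
    nlinarith [abs_nonneg (sigma T t - t)]
  linarith [abs_eq_zero.1 (le_antisymm h0 (abs_nonneg _))]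

lemma HasDeltaDerivAt.congr {T : Set ℝ} {f g : ℝ → ℝ} {d t : ℝ}
    (hσ : sigma T t ∈ T) (hfg : EqOn f g T) (h : HasDeltaDerivAt T f d t) :
    HasDeltaDerivAt T g d t := by
  intro ε hε
  obtain ⟨U, hU, h⟩ := h ε hε
  refine ⟨U, hU, fun s hs => ?_⟩
  rw [← hfg hσ, ← hfg hs.2]
  exact h s hs

lemma HasDeltaDerivAt.add {T : Set ℝ} {f g : ℝ → ℝ} {d e t : ℝ}
    (hf : HasDeltaDerivAt T f d t) (hg : HasDeltaDerivAt T g e t) :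
    HasDeltaDerivAt T (fun s => f s + g s) (d + e) t := by
  rw [hasDeltaDerivAt_iff_isLittleO] at *
  refine (hf.add hg).congr_left fun s => ?_
  ring

lemma HasDeltaDerivAt.const_mul {T : Set ℝ} {f : ℝ → ℝ} {d t : ℝ} (c : ℝ)
    (hf : HasDeltaDerivAt T f d t) :
    HasDeltaDerivAt T (fun s => c * f s) (c * d) t := by
  rw [hasDeltaDerivAt_iff_isLittleO] at *
  refine (hf.const_mul_left c).congr_left fun s => ?_
  ring

/-- The product rule `(f g)^Δ = f^Δ g + (f ∘ σ) g^Δ`. -/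
lemma HasDeltaDerivAt.mul {T : Set ℝ} {f g : ℝ → ℝ} {d e t : ℝ} (hgc : ContinuousWithinAt g T t)
    (hf : HasDeltaDerivAt T f d t) (hg : HasDeltaDerivAt T g e t) :
    HasDeltaDerivAt T (fun s => f s * g s) (d * g t + f (sigma T t) * e) t := by
  rw [hasDeltaDerivAt_iff_isLittleO] at *
  have h1 := hg.const_mul_left (f (sigma T t))
  have h2 : (fun s => g s * (f (sigma T t) - f s - d * (sigma T t - s))) =o[𝓝[T] t]
      (fun s => sigma T t - s) := by
    simpa using hgc.isBigO_one ℝ |>.mul_isLittleO hf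
  have h3 : (fun s => (d * (g s - g t)) * (sigma T t - s)) =o[𝓝[T] t]
      (fun s => sigma T t - s) := by
    have h0 : Tendsto (fun s => d * (g s - g t)) (𝓝[T] t) (𝓝 0) := by
      simpa using (tendsto_const_nhds (x := d)).mul (hgc.sub (tendsto_const_nhds (x := g t)))
    simpa using ((isLittleO_one_iff ℝ).2 h0).mul_isBigO (isBigO_refl (fun s => sigma T t - s) _)
  refine ((h1.add h2).add h3).congr_left fun s => ?_
  ring

lemma mem_kappa_of_lt {S : Set ℝ} (hS : IsCompact S) {t : ℝ} (ht : t ∈ S) (h : t < sSup S) :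
    t ∈ kappa S :=
  ⟨ht, fun h' => absurd (le_rho hS ht h) (not_le.2 h'.1)⟩

lemma kappa_subset (S : Set ℝ) : kappa S ⊆ S := sdiff_subset

lemma kappa_eq {S : Set ℝ} (hS : IsCompact S) : kappa S = S ∩ Iic (rho S (sSup S)) := by
  ext t
  simp only [kappa, Set.mem_sdiff, mem_Ioc, mem_inter_iff, mem_Iic, not_and, not_le]
  refine and_congr_right fun ht => ⟨fun h => ?_, fun h h' => absurd h (not_le.2 h')⟩
  by_contra! h'
  exact absurd (le_csSup hS.bddAbove ht) (not_le.2 (h h'))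

/-- A point of `S^κ` is right-scattered or an accumulation point of `S`. -/
lemma lt_sigma_or_accPt {S : Set ℝ} (hS : IsCompact S) (hnt : S.Nontrivial) {t : ℝ}
    (ht : t ∈ kappa S) : t < sigma S t ∨ AccPt t (𝓟 S) := by
  have htS := kappa_subset S ht
  have hle := le_csSup hS.bddAbove htS
  rcases (le_sigma hle).lt_or_eq with h | h
  · exact Or.inl h
  right
  rw [accPt_principal_iff_nhdsWithin]
  rcases hle.lt_or_eq with hlt | heq
  · exact (neBot_right_of_sigma_eq hS hnt.nonempty hlt h.symm).mono
      (nhdsWithin_mono _ fun s hs => ⟨hs.1, ne_of_gt hs.2⟩)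
  · have hρ : t ≤ rho S t := by
      rw [kappa_eq hS, ← heq] at ht
      exact ht.2
    obtain ⟨s, hs, hst⟩ := hnt.exists_ne t
    have hne : {s ∈ S | s < t}.Nonempty :=
      ⟨s, hs, lt_of_le_of_ne (heq ▸ le_csSup hS.bddAbove hs) hst⟩
    rw [rho, if_pos hne] at hρ
    have : (𝓝[S ∩ Iio t] t).NeBot := by
      refine neBot_left_iff.2 fun u hu => ?_
      obtain ⟨v, hv, huv⟩ := exists_lt_of_lt_csSup hne (hu.trans_le hρ)
      exact ⟨v, hv.1, huv, hv.2⟩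
    exact this.mono (nhdsWithin_mono _ fun s hs => ⟨hs.1, ne_of_lt hs.2⟩)

lemma HasDeltaDerivAt.unique {S : Set ℝ} (hS : IsCompact S) (hnt : S.Nontrivial) {f : ℝ → ℝ}
    {t d e : ℝ} (ht : t ∈ kappa S) (hd : HasDeltaDerivAt S f d t) (he : HasDeltaDerivAt S f e t) :
    d = e := by
  have htS := kappa_subset S ht
  rcases (le_sigma (le_csSup hS.bddAbove htS)).lt_or_eq with h | h
  · exact mul_right_cancel₀ (sub_ne_zero.2 h.ne') ((hd.sub_eq htS).symm.trans (he.sub_eq htS))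
  · have hacc := (lt_sigma_or_accPt hS hnt ht).resolve_left h.not_lt
    rw [hasDeltaDerivAt_iff_of_sigma_eq h.symm] at hd he
    exact (uniqueDiffWithinAt_iff_accPt.2 hacc).eq_deriv _ hd he

lemma deltaDeriv_eq {S : Set ℝ} (hS : IsCompact S) (hnt : S.Nontrivial) {f : ℝ → ℝ}
    {t d : ℝ} (ht : t ∈ kappa S) (hd : HasDeltaDerivAt S f d t) : deltaDeriv S f t = d := by
  have h : DeltaDifferentiableAt S f t := ⟨d, hd⟩
  rw [deltaDeriv, dif_pos h]
  exact HasDeltaDerivAt.unique hS hnt ht h.choose_spec hd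

lemma DeltaDifferentiableAt.hasDeltaDerivAt {S : Set ℝ} {f : ℝ → ℝ} {t : ℝ}
    (h : DeltaDifferentiableAt S f t) : HasDeltaDerivAt S f (deltaDeriv S f t) t := by
  rw [deltaDeriv, dif_pos h]
  exact h.choose_spec

/-! ### Piecewise rd-continuous functions -/

/-- Piecewise rd-continuity in a form that mentions no jump operator: one-sided limits exist
everywhere, and `f` is continuous at all but finitely many of the points at which `S` accumulates
from the right.  For compact `S` it is equivalent to `PiecewiseRdContinuous`, and it is insensitive
to an isolated maximum of `S`. -/
structure PrdOn (S : Set ℝ) (f : ℝ → ℝ) : Prop where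
  left : ∀ t ∈ S, ∃ l : ℝ, Tendsto f (𝓝[S ∩ Iio t] t) (𝓝 l)
  right : ∀ t ∈ S, ∃ l : ℝ, Tendsto f (𝓝[S ∩ Ioi t] t) (𝓝 l)
  finite : {t ∈ S | (𝓝[S ∩ Ioi t] t).NeBot ∧ ¬ ContinuousWithinAt f S t}.Finite

lemma piecewiseRdContinuous_iff {S : Set ℝ} (hS : IsCompact S) (hne : S.Nonempty) {f : ℝ → ℝ} :
    PiecewiseRdContinuous S f ↔ PrdOn S f := by
  constructor
  · rintro ⟨hreg, hfin⟩
    refine ⟨fun t ht => (hreg t ht).1, fun t ht => (hreg t ht).2, hfin.subset ?_⟩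
    rintro t ⟨ht, hnb, hc⟩
    exact ⟨ht, fun h => hc (h.1 (sigma_eq_of_neBot_right hS ht hnb))⟩
  · intro h
    refine ⟨fun t ht => ⟨h.left t ht, h.right t ht⟩,
      (h.finite.union (finite_singleton (sSup S))).subset ?_⟩
    rintro t ⟨ht, hrd⟩
    rcases (le_csSup hS.bddAbove ht).lt_or_eq with hlt | heq
    · left
      have : ¬ (sigma S t = t → ContinuousWithinAt f S t) := fun h' =>
        hrd ⟨h', fun _ => h.left t ht⟩
      push Not at this
      exact ⟨ht, neBot_right_of_sigma_eq hS hne hlt this.1, this.2⟩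
    · exact Or.inr heq

lemma PrdOn.of_continuousOn {S : Set ℝ} {f : ℝ → ℝ} (hf : ContinuousOn f S) : PrdOn S f where
  left t ht := ⟨f t, (hf t ht).mono inter_subset_left⟩
  right t ht := ⟨f t, (hf t ht).mono inter_subset_left⟩
  finite := by
    convert finite_empty
    ext t
    simp only [mem_ofPred_eq, mem_empty_iff_false, iff_false, not_and, not_not]
    exact fun ht _ => hf t ht

/-- Piecewise rd-continuous functions are stable under superposition with a function that is
continuous in all variables. -/
lemma PrdOn.comp {S : Set ℝ} {n : ℕ} {Φ : ℝ × (Fin n → ℝ) → ℝ} (hΦ : ContinuousOn Φ (S ×ˢ univ))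
    {u : ℝ → Fin n → ℝ} (hu : ∀ i, PrdOn S fun t => u t i) : PrdOn S fun t => Φ (t, u t) := by
  have key : ∀ t ∈ S, ∀ A ⊆ S, ∀ l : Fin n → ℝ, (∀ i, Tendsto (fun s => u s i) (𝓝[A] t) (𝓝 (l i)))
      → Tendsto (fun s => Φ (s, u s)) (𝓝[A] t) (𝓝 (Φ (t, l))) := by
    intro t ht A hA l hl
    have h1 : Tendsto (fun s => (s, u s)) (𝓝[A] t) (𝓝[S ×ˢ univ] (t, l)) := by
      refine tendsto_nhdsWithin_iff.2 ⟨?_, ?_⟩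
      · exact Tendsto.prodMk_nhds nhdsWithin_le_nhds (tendsto_pi_nhds.2 hl)
      · filter_upwards [self_mem_nhdsWithin] with s hs
        exact ⟨hA hs, mem_univ _⟩
    exact (hΦ (t, l) ⟨ht, mem_univ _⟩).tendsto.comp h1
  refine ⟨fun t ht => ?_, fun t ht => ?_, ?_⟩
  · choose l hl using fun i => (hu i).left t ht
    exact ⟨_, key t ht _ inter_subset_left l hl⟩
  · choose l hl using fun i => (hu i).right t ht
    exact ⟨_, key t ht _ inter_subset_left l hl⟩
  · refine (finite_iUnion fun i => (hu i).finite).subset ?_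
    rintro t ⟨ht, hnb, hc⟩
    by_contra hcon
    simp only [mem_iUnion, not_exists, mem_ofPred_eq, not_and, not_not] at hcon
    exact hc (key t ht S subset_rfl _ fun i => hcon i ht hnb)

lemma PrdOn.comp₂ {S : Set ℝ} {Φ : ℝ → ℝ → ℝ} (hΦ : Continuous fun p : ℝ × ℝ => Φ p.1 p.2)
    {f g : ℝ → ℝ} (hf : PrdOn S f) (hg : PrdOn S g) : PrdOn S fun t => Φ (f t) (g t) := by
  have := PrdOn.comp (S := S) (n := 2) (Φ := fun p => Φ (p.2 0) (p.2 1)) (u := fun t => ![f t, g t])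
    (Continuous.continuousOn (by fun_prop)) (by simp [Fin.forall_fin_two, hf, hg])
  simpa using this

lemma PrdOn.add {S : Set ℝ} {f g : ℝ → ℝ} (hf : PrdOn S f) (hg : PrdOn S g) :
    PrdOn S fun t => f t + g t := PrdOn.comp₂ (Φ := fun x y => x + y) (by fun_prop) hf hg

lemma PrdOn.sub {S : Set ℝ} {f g : ℝ → ℝ} (hf : PrdOn S f) (hg : PrdOn S g) :
    PrdOn S fun t => f t - g t := PrdOn.comp₂ (Φ := fun x y => x - y) (by fun_prop) hf hg

lemma PrdOn.mul {S : Set ℝ} {f g : ℝ → ℝ} (hf : PrdOn S f) (hg : PrdOn S g) :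
    PrdOn S fun t => f t * g t := PrdOn.comp₂ (Φ := fun x y => x * y) (by fun_prop) hf hg

lemma PrdOn.const {S : Set ℝ} (c : ℝ) : PrdOn S fun _ => c := .of_continuousOn continuousOn_const

lemma PrdOn.const_mul {S : Set ℝ} (c : ℝ) {f : ℝ → ℝ} (hf : PrdOn S f) :
    PrdOn S fun t => c * f t := (PrdOn.const c).mul hf

lemma PrdOn.sum {S : Set ℝ} {ι : Type*} (s : Finset ι) {f : ι → ℝ → ℝ}
    (hf : ∀ i ∈ s, PrdOn S (f i)) : PrdOn S fun t => ∑ i ∈ s, f i t := by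
  classical
  induction s using Finset.induction_on with
  | empty => simpa using PrdOn.const 0
  | insert i s hi ih =>
    simp only [Finset.sum_insert hi]
    exact (hf i (Finset.mem_insert_self _ _)).add
      (ih fun j hj => hf j (Finset.mem_insert_of_mem hj))

/-- Changing finitely many values preserves piecewise rd-continuity. -/
lemma PrdOn.congr_off_finite {S : Set ℝ} {f g : ℝ → ℝ} {E : Set ℝ} (hE : E.Finite)
    (hfg : ∀ t ∈ S \ E, f t = g t) (hf : PrdOn S f) : PrdOn S g := by
  have hev : ∀ t, ∀ A ⊆ S, t ∉ A → f =ᶠ[𝓝[A] t] g := by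
    intro t A hA htA
    have h1 : (E \ {t})ᶜ ∈ 𝓝 t := (hE.subset sdiff_subset).isClosed.isOpen_compl.mem_nhds (by simp)
    filter_upwards [self_mem_nhdsWithin, nhdsWithin_le_nhds h1] with s hs hsE
    refine hfg s ⟨hA hs, fun h => hsE ⟨h, ?_⟩⟩
    rintro rfl
    exact htA hs
  have hl : ∀ t, t ∉ S ∩ Iio t := fun t h => lt_irrefl t h.2
  have hr : ∀ t, t ∉ S ∩ Ioi t := fun t h => lt_irrefl t h.2
  refine ⟨fun t ht => ?_, fun t ht => ?_, ?_⟩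
  · obtain ⟨l, h⟩ := hf.left t ht
    exact ⟨l, h.congr' (hev t _ inter_subset_left (hl t))⟩
  · obtain ⟨l, h⟩ := hf.right t ht
    exact ⟨l, h.congr' (hev t _ inter_subset_left (hr t))⟩
  · refine (hf.finite.union hE).subset ?_
    rintro t ⟨ht, hnb, hc⟩
    by_contra hcon
    simp only [mem_union, mem_ofPred_eq, not_or, not_and, not_not] at hcon
    have hft := hcon.1 ht hnb
    rw [continuousWithinAt_iff_left_right ht, hfg t ⟨ht, hcon.2⟩] at hft
    exact hc ((continuousWithinAt_iff_left_right ht).2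
      ⟨hft.1.congr' (hev t _ inter_subset_left (hl t)),
        hft.2.congr' (hev t _ inter_subset_left (hr t))⟩)

lemma kappa_inter_Iio {S : Set ℝ} (hS : IsCompact S) {t : ℝ} (ht : t ∈ S) :
    kappa S ∩ Iio t = S ∩ Iio t := by
  ext s
  refine ⟨fun h => ⟨kappa_subset S h.1, h.2⟩, fun h => ⟨mem_kappa_of_lt hS h.1 ?_, h.2⟩⟩
  exact lt_of_lt_of_le h.2 (le_csSup hS.bddAbove ht)

lemma nhdsWithin_kappa_inter {S : Set ℝ} (hS : IsCompact S) {t : ℝ} (ht : t < sSup S) (A : Set ℝ) :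
    𝓝[kappa S ∩ A] t = 𝓝[S ∩ A] t := by
  refine nhdsWithin_eq_nhdsWithin (mem_Iio.2 ht) isOpen_Iio ?_
  ext s
  exact ⟨fun h => ⟨⟨kappa_subset S h.1.1, h.1.2⟩, h.2⟩,
    fun h => ⟨⟨mem_kappa_of_lt hS h.1.1 h.2, h.1.2⟩, h.2⟩⟩

lemma not_neBot_right_sSup {S A : Set ℝ} (hS : IsCompact S) (hA : A ⊆ S) :
    ¬ (𝓝[A ∩ Ioi (sSup S)] (sSup S)).NeBot := by
  have : A ∩ Ioi (sSup S) = ∅ := by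
    ext s
    simp only [mem_inter_iff, mem_Ioi, mem_empty_iff_false, iff_false, not_and, not_lt]
    exact fun h => le_csSup hS.bddAbove (hA h)
  simp [this]

/-- Piecewise rd-continuity on `S` and on `S^κ` are the same notion. -/
lemma prdOn_kappa_iff {S : Set ℝ} (hS : IsCompact S) {f : ℝ → ℝ} :
    PrdOn (kappa S) f ↔ PrdOn S f := by
  have hbad : {t ∈ kappa S | (𝓝[kappa S ∩ Ioi t] t).NeBot ∧ ¬ ContinuousWithinAt f (kappa S) t} =
      {t ∈ S | (𝓝[S ∩ Ioi t] t).NeBot ∧ ¬ ContinuousWithinAt f S t} := by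
    ext t
    simp only [mem_ofPred_eq]
    by_cases hlt : t < sSup S
    · have h1 := nhdsWithin_kappa_inter hS hlt univ
      rw [inter_univ, inter_univ] at h1
      rw [nhdsWithin_kappa_inter hS hlt, ContinuousWithinAt, ContinuousWithinAt, h1]
      exact and_congr_left fun _ => ⟨fun h => kappa_subset S h, fun h => mem_kappa_of_lt hS h hlt⟩
    · constructor
      · rintro ⟨h1, h2, _⟩
        have := le_antisymm (le_csSup hS.bddAbove (kappa_subset S h1)) (not_lt.1 hlt)
        subst this
        exact absurd h2 (not_neBot_right_sSup hS (kappa_subset S))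
      · rintro ⟨h1, h2, _⟩
        have := le_antisymm (le_csSup hS.bddAbove h1) (not_lt.1 hlt)
        subst this
        exact absurd h2 (not_neBot_right_sSup hS subset_rfl)
  constructor
  · intro h
    refine ⟨fun t ht => ?_, fun t ht => ?_, hbad ▸ h.finite⟩
    · by_cases htK : t ∈ kappa S
      · rw [← kappa_inter_Iio hS ht]
        exact h.left t htK
      · -- the only candidate for such a point is a left-scattered maximum
        have hBt : sSup S = t := by
          by_contra hcon
          exact htK (mem_kappa_of_lt hS ht (lt_of_le_of_ne (le_csSup hS.bddAbove ht)
            (Ne.symm hcon)))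
        rw [kappa_eq hS, hBt] at htK
        have hlt : rho S t < t := by
          by_contra! hcon
          exact htK ⟨ht, hcon⟩
        have : ¬ (𝓝[S ∩ Iio t] t).NeBot := by
          intro hnb
          obtain ⟨s, hs, h1, h2⟩ := neBot_left_iff.1 hnb _ hlt
          exact absurd (le_rho hS hs h2) (not_le.2 h1)
        rw [not_neBot.1 this]
        exact ⟨0, tendsto_bot⟩
    · by_cases hlt : t < sSup S
      · rw [← nhdsWithin_kappa_inter hS hlt]
        exact h.right t (mem_kappa_of_lt hS ht hlt)
      · have := le_antisymm (le_csSup hS.bddAbove ht) (not_lt.1 hlt)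
        subst this
        rw [not_neBot.1 (not_neBot_right_sSup hS subset_rfl)]
        exact ⟨0, tendsto_bot⟩
  · intro h
    refine ⟨fun t ht => ?_, fun t ht => ?_, hbad ▸ h.finite⟩
    · rw [kappa_inter_Iio hS (kappa_subset S ht)]
      exact h.left t (kappa_subset S ht)
    · obtain ⟨l, hl⟩ := h.right t (kappa_subset S ht)
      exact ⟨l, hl.mono_left (nhdsWithin_mono _ (inter_subset_inter_left _ (kappa_subset S)))⟩

/-- If `F` is continuous on `S`, then `F ∘ σ` is continuous at right-dense points. -/
lemma continuousWithinAt_comp_sigma {S : Set ℝ} (hS : IsCompact S) (hne : S.Nonempty) {F : ℝ → ℝ}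
    (hF : ContinuousOn F S) {t : ℝ} (ht : t ∈ S) (h : sigma S t = t) :
    ContinuousWithinAt (fun s => F (sigma S s)) S t := by
  rw [continuousWithinAt_iff_left_right ht]
  simp only [h]
  exact ⟨(hF t ht).tendsto.comp (tendsto_sigma_left hS hne ht),
    (hF t ht).tendsto.comp (tendsto_sigma_right hS hne)⟩

lemma PrdOn.comp_sigma {S : Set ℝ} (hS : IsCompact S) (hne : S.Nonempty) {F : ℝ → ℝ}
    (hF : ContinuousOn F S) : PrdOn S fun t => F (sigma S t) where
  left t ht := ⟨F t, (hF t ht).tendsto.comp (tendsto_sigma_left hS hne ht)⟩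
  right t ht := ⟨F t, (hF t ht).tendsto.comp (tendsto_sigma_right hS hne)⟩
  finite := by
    convert finite_empty
    ext t
    simp only [mem_ofPred_eq, mem_empty_iff_false, iff_false, not_and, not_not]
    exact fun ht hnb =>
      continuousWithinAt_comp_sigma hS hne hF ht (sigma_eq_of_neBot_right hS ht hnb)

lemma PrdOn.exists_bound {S : Set ℝ} (hS : IsCompact S) {f : ℝ → ℝ} (hf : PrdOn S f) :
    ∃ M, ∀ t ∈ S, |f t| ≤ M := by
  refine hS.induction_on (p := fun A => ∃ M, ∀ t ∈ A, |f t| ≤ M) ⟨0, by simp⟩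
    (fun A B hAB ⟨M, hM⟩ => ⟨M, fun t ht => hM t (hAB ht)⟩) ?_ ?_
  · rintro A B ⟨M, hM⟩ ⟨N, hN⟩
    refine ⟨max M N, fun t ht => ?_⟩
    rcases ht with ht | ht
    · exact (hM t ht).trans (le_max_left _ _)
    · exact (hN t ht).trans (le_max_right _ _)
  · intro t ht
    obtain ⟨l, hl⟩ := hf.left t ht
    obtain ⟨m, hm⟩ := hf.right t ht
    refine ⟨{s | |f s| ≤ max (max (|l| + 1) |f t|) (|m| + 1)}, ?_, _, fun s hs => hs⟩
    rw [nhdsWithin_eq_left_sup_right ht, mem_sup, mem_sup]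
    refine ⟨⟨?_, ?_⟩, ?_⟩
    · filter_upwards [hl.abs.eventually_lt_const (lt_add_one |l|)] with s hs
      exact hs.le.trans ((le_max_left _ _).trans (le_max_left _ _))
    · have h : |f t| ≤ max (max (|l| + 1) |f t|) (|m| + 1) :=
        (le_max_right _ _).trans (le_max_left _ _)
      exact h
    · filter_upwards [hm.abs.eventually_lt_const (lt_add_one |m|)] with s hs
      exact hs.le.trans (le_max_right _ _)

lemma PrdOn.measurable_indicator {S : Set ℝ} (hS : IsCompact S) {f : ℝ → ℝ} (hf : PrdOn S f) :
    Measurable (S.indicator f) := by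
  classical
  -- discontinuities occur at points isolated from the right, and at finitely many others
  set C : Set ℝ := {t ∈ S | 𝓝[S ∩ Ioi t] t = ⊥} ∪
    {t ∈ S | (𝓝[S ∩ Ioi t] t).NeBot ∧ ¬ ContinuousWithinAt f S t} with hC
  have hCc : C.Countable := countable_setOfPred_isolated_right_within.union hf.finite.countable
  have hc : ContinuousOn f (S \ C) := by
    intro t ht
    have h : ContinuousWithinAt f S t := by
      by_contra hcon
      refine ht.2 ?_
      by_cases hb : 𝓝[S ∩ Ioi t] t = ⊥
      · exact Or.inl ⟨ht.1, hb⟩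
      · exact Or.inr ⟨ht.1, ⟨hb⟩, hcon⟩
    exact h.mono sdiff_subset
  have h1 : Measurable ((S \ C).indicator f) := by
    rw [← piecewise_eq_indicator]
    exact hc.measurable_piecewise continuousOn_const
      (hS.isClosed.measurableSet.diff hCc.measurableSet)
  suffices hsub : {t | (S \ C).indicator f t ≠ S.indicator f t} ⊆ C from
    h1.measurable_of_countable_ne (hCc.mono hsub)
  intro t ht
  by_contra htC
  refine ht ?_
  by_cases htS : t ∈ S
  · have htSC : t ∈ S \ C := ⟨htS, htC⟩
    rw [indicator_of_mem htS, indicator_of_mem htSC]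
  · rw [indicator_of_notMem htS, indicator_of_notMem fun h => htS h.1]

/-! ### The delta integral as a Lebesgue integral -/

/-- The largest point of `S` not exceeding `x`, or `min S` if there is none. -/
def retract (S : Set ℝ) (x : ℝ) : ℝ := sSup (S ∩ Iic (max x (sInf S)))

lemma retract_mem_inter {S : Set ℝ} (hS : IsCompact S) (hne : S.Nonempty) (x : ℝ) :
    retract S x ∈ S ∩ Iic (max x (sInf S)) :=
  (hS.inter_right isClosed_Iic).sSup_mem ⟨sInf S, hS.sInf_mem hne, mem_Iic.2 (le_max_right _ _)⟩

lemma retract_mem {S : Set ℝ} (hS : IsCompact S) (hne : S.Nonempty) (x : ℝ) : retract S x ∈ S :=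
  (retract_mem_inter hS hne x).1

lemma retract_le {S : Set ℝ} (hS : IsCompact S) (hne : S.Nonempty) {x : ℝ} (hx : sInf S ≤ x) :
    retract S x ≤ x :=
  (retract_mem_inter hS hne x).2.trans_eq (max_eq_left hx)

lemma le_retract {S : Set ℝ} (hS : IsCompact S) {s x : ℝ} (hs : s ∈ S) (hsx : s ≤ x) :
    s ≤ retract S x :=
  le_csSup (hS.inter_right isClosed_Iic).bddAbove ⟨hs, hsx.trans (le_max_left _ _)⟩

lemma retract_mono {S : Set ℝ} (hS : IsCompact S) (hne : S.Nonempty) : Monotone (retract S) :=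
  fun x _ hxy => csSup_le_csSup (hS.inter_right isClosed_Iic).bddAbove
    ⟨_, retract_mem_inter hS hne x⟩
    (inter_subset_inter_right _ (Iic_subset_Iic.2 (max_le_max_right _ hxy)))

lemma retract_eq_of_lt_sigma {S : Set ℝ} (hS : IsCompact S) {t x : ℝ} (ht : t ∈ S) (htx : t ≤ x)
    (hx : x < sigma S t) : retract S x = t := by
  refine le_antisymm (not_lt.1 fun h => ?_) (le_retract hS ht htx)
  have h1 := sigma_le hS (retract_mem hS ⟨t, ht⟩ x) h
  have h2 := retract_le hS ⟨t, ht⟩ ((csInf_le hS.bddBelow ht).trans htx)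
  linarith

lemma tendsto_retract_right {S : Set ℝ} (hS : IsCompact S) {t : ℝ} (ht : t ∈ S)
    (hnb : (𝓝[S ∩ Ioi t] t).NeBot) : Tendsto (retract S) (𝓝[>] t) (𝓝[S ∩ Ioi t] t) := by
  have hle : ∀ x, t < x → retract S x ≤ x := fun x hx =>
    retract_le hS ⟨t, ht⟩ ((csInf_le hS.bddBelow ht).trans hx.le)
  have hlt : ∀ x, t < x → t < retract S x := fun x hx => by
    obtain ⟨s, hs, h1, h2⟩ := neBot_right_iff.1 hnb x hx
    exact h1.trans_le (le_retract hS hs h2.le)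
  refine tendsto_nhdsWithin_iff.2 ⟨?_, ?_⟩
  · have hid : Tendsto (fun s : ℝ => s) (𝓝[>] t) (𝓝 t) := nhdsWithin_le_nhds
    refine tendsto_of_tendsto_of_tendsto_of_le_of_le' tendsto_const_nhds hid ?_ ?_
    · filter_upwards [self_mem_nhdsWithin] with x hx using (hlt x hx).le
    · filter_upwards [self_mem_nhdsWithin] with x hx using hle x hx
  · filter_upwards [self_mem_nhdsWithin] with x hx
    exact ⟨retract_mem hS ⟨t, ht⟩ x, hlt x hx⟩

lemma tendsto_retract_left {S : Set ℝ} (hS : IsCompact S) {t : ℝ} (ht : t ∈ S)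
    (hnb : (𝓝[S ∩ Iio t] t).NeBot) : Tendsto (retract S) (𝓝[<] t) (𝓝[S ∩ Iio t] t) := by
  obtain ⟨s₀, hs₀, -, hs₀t⟩ := neBot_left_iff.1 hnb (t - 1) (by linarith)
  have hle : ∀ᶠ x in 𝓝[<] t, retract S x ≤ x := by
    filter_upwards [nhdsWithin_le_nhds (Ioi_mem_nhds hs₀t)] with x hx
    exact retract_le hS ⟨t, ht⟩ ((csInf_le hS.bddBelow hs₀).trans (le_of_lt hx))
  refine tendsto_nhdsWithin_iff.2 ⟨tendsto_order.2 ⟨fun u hu => ?_, fun u hu => ?_⟩, ?_⟩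
  · obtain ⟨s, hs, h1, h2⟩ := neBot_left_iff.1 hnb u hu
    filter_upwards [nhdsWithin_le_nhds (Ioi_mem_nhds h2)] with x hx
    exact h1.trans_le (le_retract hS hs (le_of_lt hx))
  · filter_upwards [hle, self_mem_nhdsWithin] with x hx hxt
    exact (hx.trans_lt hxt).trans hu
  · filter_upwards [hle, self_mem_nhdsWithin] with x hx hxt
    exact ⟨retract_mem hS ⟨t, ht⟩ x, hx.trans_lt hxt⟩

/-- `∫_{min S}^t f Δ`, computed as the Lebesgue integral of the extension of `f` that is constant on
the gaps of `S`. -/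
def primitive (S : Set ℝ) (f : ℝ → ℝ) (t : ℝ) : ℝ := ∫ x in (sInf S)..t, f (retract S x)

lemma PrdOn.measurable_comp_retract {S : Set ℝ} (hS : IsCompact S) (hne : S.Nonempty) {f : ℝ → ℝ}
    (hf : PrdOn S f) : Measurable fun x => f (retract S x) := by
  convert (hf.measurable_indicator hS).comp (retract_mono hS hne).measurable using 1
  ext x
  simp [indicator_of_mem (retract_mem hS hne x)]

lemma PrdOn.intervalIntegrable {S : Set ℝ} (hS : IsCompact S) (hne : S.Nonempty) {f : ℝ → ℝ}
    (hf : PrdOn S f) (c d : ℝ) : IntervalIntegrable (fun x => f (retract S x)) volume c d := by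
  obtain ⟨M, hM⟩ := hf.exists_bound hS
  refine (intervalIntegrable_const (c := M)).mono_fun
    (hf.measurable_comp_retract hS hne).aestronglyMeasurable ?_
  refine Eventually.of_forall fun x => ?_
  exact (hM _ (retract_mem hS hne x)).trans (le_abs_self M)

lemma primitive_sInf (S : Set ℝ) (f : ℝ → ℝ) : primitive S f (sInf S) = 0 :=
  intervalIntegral.integral_same

lemma PrdOn.primitive_sub {S : Set ℝ} (hS : IsCompact S) (hne : S.Nonempty) {f : ℝ → ℝ}
    (hf : PrdOn S f) (c d : ℝ) :
    primitive S f d - primitive S f c = ∫ x in c..d, f (retract S x) :=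
  intervalIntegral.integral_interval_sub_left (hf.intervalIntegrable hS hne _ _)
    (hf.intervalIntegrable hS hne _ _)

lemma PrdOn.continuous_primitive {S : Set ℝ} (hS : IsCompact S) (hne : S.Nonempty) {f : ℝ → ℝ}
    (hf : PrdOn S f) : Continuous (primitive S f) :=
  intervalIntegral.continuous_primitive (hf.intervalIntegrable hS hne) _

/-- One-sided fundamental theorem of calculus, at a right-sided limit of the integrand. -/
lemma PrdOn.tendsto_slope_right {S : Set ℝ} (hS : IsCompact S) {f : ℝ → ℝ}
    (hf : PrdOn S f) {t l : ℝ} (ht : t ∈ S) (hl : Tendsto f (𝓝[S ∩ Ioi t] t) (𝓝 l)) :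
    Tendsto (slope (primitive S f) t) (𝓝[S ∩ Ioi t] t) (𝓝 l) := by
  by_cases hnb : (𝓝[S ∩ Ioi t] t).NeBot
  · have h1 : HasDerivWithinAt (primitive S f) l (Ici t) t := by
      refine intervalIntegral.integral_hasDerivWithinAt_of_tendsto_ae_right (t := Ioi t)
        (hf.intervalIntegrable hS ⟨t, ht⟩ _ _)
        (hf.measurable_comp_retract hS ⟨t, ht⟩).stronglyMeasurable.stronglyMeasurableAtFilter ?_
      exact (hl.comp (tendsto_retract_right hS ht hnb)).mono_left inf_le_left
    rw [hasDerivWithinAt_iff_tendsto_slope] at h1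
    exact h1.mono_left (nhdsWithin_mono _ fun s hs => ⟨mem_Ici.2 (le_of_lt hs.2), ne_of_gt hs.2⟩)
  · rw [not_neBot.1 hnb]
    exact tendsto_bot

/-- One-sided fundamental theorem of calculus, at a left-sided limit of the integrand. -/
lemma PrdOn.tendsto_slope_left {S : Set ℝ} (hS : IsCompact S) {f : ℝ → ℝ}
    (hf : PrdOn S f) {t l : ℝ} (ht : t ∈ S) (hl : Tendsto f (𝓝[S ∩ Iio t] t) (𝓝 l)) :
    Tendsto (slope (primitive S f) t) (𝓝[S ∩ Iio t] t) (𝓝 l) := by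
  by_cases hnb : (𝓝[S ∩ Iio t] t).NeBot
  · have hae : 𝓝[≤] t ⊓ ae volume ≤ 𝓝[<] t := by
      have h0 : ({t} : Set ℝ)ᶜ ∈ ae (volume : Measure ℝ) := compl_mem_ae_iff.2 (by simp)
      have : Iic t ∩ {t}ᶜ = Iio t := by
        ext s
        simp only [mem_inter_iff, mem_Iic, mem_compl_iff, mem_singleton_iff, mem_Iio]
        exact lt_iff_le_and_ne.symm
      rw [← this, nhdsWithin_inter', inf_comm (𝓝[≤] t) (𝓟 _)]
      exact le_inf (inf_le_right.trans (le_principal_iff.2 h0)) inf_le_left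
    have h1 : HasDerivWithinAt (primitive S f) l (Iic t) t := by
      refine intervalIntegral.integral_hasDerivWithinAt_of_tendsto_ae_right (t := Iic t)
        (hf.intervalIntegrable hS ⟨t, ht⟩ _ _)
        (hf.measurable_comp_retract hS ⟨t, ht⟩).stronglyMeasurable.stronglyMeasurableAtFilter ?_
      exact (hl.comp (tendsto_retract_left hS ht hnb)).mono_left hae
    rw [hasDerivWithinAt_iff_tendsto_slope] at h1
    exact h1.mono_left (nhdsWithin_mono _ fun s hs => ⟨mem_Iic.2 (le_of_lt hs.2), ne_of_lt hs.2⟩)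
  · rw [not_neBot.1 hnb]
    exact tendsto_bot

lemma nhdsWithin_diff_singleton_eq (S : Set ℝ) (t : ℝ) :
    𝓝[S \ {t}] t = 𝓝[S ∩ Iio t] t ⊔ 𝓝[S ∩ Ioi t] t := by
  rw [← nhdsWithin_union, ← inter_union_distrib_left, Iio_union_Ioi, sdiff_eq]

lemma PrdOn.hasDeltaDerivAt_primitive {S : Set ℝ} (hS : IsCompact S) {f : ℝ → ℝ} (hf : PrdOn S f)
    {t : ℝ} (ht : t ∈ S) (hc : sigma S t = t → ContinuousWithinAt f S t) :
    HasDeltaDerivAt S (primitive S f) (f t) t := by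
  rcases (le_sigma (le_csSup hS.bddAbove ht)).lt_or_eq with h | h
  · refine hasDeltaDerivAt_of_lt_sigma h
      (hf.continuous_primitive hS ⟨t, ht⟩).continuousWithinAt ?_
    rw [hf.primitive_sub hS ⟨t, ht⟩]
    have : ∫ x in t..sigma S t, f (retract S x) = ∫ x in t..sigma S t, f t := by
      refine intervalIntegral.integral_congr_Ioo_of_le h.le fun x hx => ?_
      simp only [retract_eq_of_lt_sigma hS ht hx.1.le hx.2]
    rw [this, intervalIntegral.integral_const, smul_eq_mul, mul_comm]
  · rw [hasDeltaDerivAt_iff_of_sigma_eq h.symm, hasDerivWithinAt_iff_tendsto_slope,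
      nhdsWithin_diff_singleton_eq, tendsto_sup]
    have := (continuousWithinAt_iff_left_right ht).1 (hc h.symm)
    exact ⟨hf.tendsto_slope_left hS ht this.1, hf.tendsto_slope_right hS ht this.2⟩

lemma PrdOn.isDeltaAntideriv_primitive {S : Set ℝ} (hS : IsCompact S) (hne : S.Nonempty)
    {f : ℝ → ℝ} (hf : PrdOn S f) : IsDeltaAntideriv S f (primitive S f) := by
  refine ⟨(hf.continuous_primitive hS hne).continuousOn,
    {t ∈ S | ¬ RdContinuousAt S f t} ∩ {t | sigma S t = t}, ?_, fun t ht => ht.2, ?_⟩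
  · exact ((piecewiseRdContinuous_iff hS hne).2 hf).2.inter_of_left _
  · rintro t ⟨ht, htD⟩
    have htS := kappa_subset S ht
    refine hf.hasDeltaDerivAt_primitive hS htS fun h => ?_
    by_contra hcon
    exact htD ⟨⟨htS, fun hrd => hcon (hrd.1 h)⟩, h⟩

/-- A continuous function on `S` whose delta derivative vanishes except at finitely many right-dense
points is constant. -/
lemma eq_of_hasDeltaDerivAt_zero {S : Set ℝ} (hS : IsCompact S) (hne : S.Nonempty) {H : ℝ → ℝ}
    (hc : ContinuousOn H S) (D : Finset ℝ) (hD : ∀ t ∈ D, sigma S t = t)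
    (hd : ∀ t ∈ kappa S, t ∉ D → HasDeltaDerivAt S H 0 t) {t : ℝ} (ht : t ∈ S) :
    H t = H (sInf S) := by
  set a := sInf S with ha
  have haS : a ∈ S := hS.sInf_mem hne
  -- each exceptional point may contribute an error `ε`, by continuity
  suffices key : ∀ ε > 0, ∀ s ∈ S, |H s - H a| ≤ ε * ((s - a) + (D.filter (· < s)).card) by
    have h0 : |H t - H a| ≤ 0 := by
      have hlim : Tendsto (fun ε : ℝ => ε * ((t - a) + (D.filter (· < t)).card)) (𝓝[>] 0)
          (𝓝 0) := by
        have : Tendsto (fun ε : ℝ => ε * ((t - a) + (D.filter (· < t)).card)) (𝓝 0)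
            (𝓝 (0 * ((t - a) + (D.filter (· < t)).card))) := tendsto_id.mul_const _
        rw [zero_mul] at this
        exact this.mono_left nhdsWithin_le_nhds
      refine ge_of_tendsto hlim ?_
      filter_upwards [self_mem_nhdsWithin] with ε hε using key ε hε t ht
    exact sub_eq_zero.1 (abs_eq_zero.1 (le_antisymm h0 (abs_nonneg _)))
  intro ε hε
  set P : ℝ → Prop := fun s => |H s - H a| ≤ ε * ((s - a) + (D.filter (· < s)).card) with hP
  have hcard : ∀ {u v : ℝ}, u ≤ v →
      ((D.filter (· < u)).card : ℝ) ≤ (D.filter (· < v)).card := fun {u v} huv =>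
    Nat.cast_le.2 (Finset.card_le_card (Finset.monotone_filter_right D fun d _ h => h.trans_le huv))
  set A : Set ℝ := {s ∈ S | ∀ v ∈ S, v ≤ s → P v} with hA
  have hAa : a ∈ A := by
    refine ⟨haS, fun v hv hva => ?_⟩
    have : v = a := le_antisymm hva (csInf_le hS.bddBelow hv)
    subst this
    simp only [hP, sub_self, abs_zero, zero_add]
    positivity
  have hAb : BddAbove A := hS.bddAbove.mono (sep_subset _ _)
  set c := sSup A with hcdef
  have hcS : c ∈ S := closure_minimal (sep_subset _ _) hS.isClosed (csSup_mem_closure ⟨a, hAa⟩ hAb)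
  have hlt : ∀ s ∈ S, s < c → P s := by
    intro s hs hsc
    obtain ⟨u, hu, hsu⟩ := exists_lt_of_lt_csSup ⟨a, hAa⟩ hsc
    exact hu.2 s hs hsu.le
  have hPc : P c := by
    by_cases hcA : c ∈ A
    · exact hcA.2 c hcS le_rfl
    have hnb : (𝓝[S ∩ Iio c] c).NeBot := by
      refine neBot_left_iff.2 fun u hu => ?_
      obtain ⟨s, hs, hus⟩ := exists_lt_of_lt_csSup ⟨a, hAa⟩ hu
      exact ⟨s, hs.1, hus, lt_of_le_of_ne (le_csSup hAb hs) fun h => hcA (h ▸ hs)⟩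
    have hlim : Tendsto (fun s => |H s - H a|) (𝓝[S ∩ Iio c] c) (𝓝 |H c - H a|) :=
      (((hc c hcS).mono inter_subset_left).tendsto.sub_const _).abs
    refine le_of_tendsto hlim ?_
    filter_upwards [self_mem_nhdsWithin] with s hs
    refine (hlt s hs.1 hs.2).trans (mul_le_mul_of_nonneg_left ?_ hε.le)
    have := hcard (le_of_lt (show s < c from hs.2))
    have h2 : s < c := hs.2
    linarith
  have hcA : c ∈ A := ⟨hcS, fun v hv hvc => hvc.lt_or_eq.elim (hlt v hv) fun h => h ▸ hPc⟩
  rcases (le_csSup hS.bddAbove hcS).lt_or_eq with hcB | hcB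
  swap
  · exact fun s hs => hcA.2 s hs (hcB ▸ le_csSup hS.bddAbove hs)
  exfalso
  rcases (le_sigma hcB.le).lt_or_eq with hσ | hσ
  · have hcD : c ∉ D := fun h => hσ.ne' (hD c h)
    have heq := (hd c (mem_kappa_of_lt hS hcS hcB) hcD).sub_eq hcS
    rw [zero_mul, sub_eq_zero] at heq
    refine absurd (le_csSup hAb (show sigma S c ∈ A from ⟨sigma_mem hS hne c, ?_⟩)) (not_le.2 hσ)
    intro v hv hvσ
    rcases le_or_gt v c with h | h
    · exact hcA.2 v hv h
    · obtain rfl : v = sigma S c := le_antisymm hvσ (sigma_le hS hv h)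
      simp only [hP, heq]
      refine hPc.trans (mul_le_mul_of_nonneg_left ?_ hε.le)
      have := hcard hσ.le
      linarith
  · have hev : ∀ᶠ s in 𝓝[S ∩ Ioi c] c, P s := by
      by_cases hcD : c ∈ D
      · have hlim : Tendsto (fun s => |H s - H c|) (𝓝[S ∩ Ioi c] c) (𝓝 0) := by
          have := (((hc c hcS).mono (inter_subset_left (t := Ioi c))).tendsto.sub_const (H c)).abs
          simpa using this
        filter_upwards [hlim.eventually_lt_const hε, self_mem_nhdsWithin] with s hs hsc
        have h1 : (D.filter (· < c)).card + 1 ≤ (D.filter (· < s)).card := by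
          rw [← Finset.card_insert_of_notMem (a := c) (by simp)]
          refine Finset.card_le_card fun d hd => ?_
          rcases Finset.mem_insert.1 hd with rfl | hd
          · exact Finset.mem_filter.2 ⟨hcD, hsc.2⟩
          · rw [Finset.mem_filter] at hd ⊢
            exact ⟨hd.1, hd.2.trans hsc.2⟩
        have h2 : ((D.filter (· < c)).card : ℝ) + 1 ≤ (D.filter (· < s)).card := by
          exact_mod_cast h1
        have h3 : c < s := hsc.2
        have h4 : ε * ((c - a) + (D.filter (· < c)).card) + ε ≤
            ε * ((s - a) + (D.filter (· < s)).card) := by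
          nlinarith
        have h5 := abs_sub_le (H s) (H c) (H a)
        have h6 : |H c - H a| ≤ ε * ((c - a) + (D.filter (· < c)).card) := hPc
        change |H s - H a| ≤ _
        linarith
      · have hder := hd c (mem_kappa_of_lt hS hcS hcB) hcD
        rw [hasDeltaDerivAt_iff_of_sigma_eq hσ.symm, hasDerivWithinAt_iff_isLittleO] at hder
        have h1 := isLittleO_iff.1 hder hε
        filter_upwards [nhdsWithin_mono _ inter_subset_left h1, self_mem_nhdsWithin] with s hs hsc
        have h3 : c < s := hsc.2
        simp only [smul_eq_mul, mul_zero, sub_zero, Real.norm_eq_abs] at hs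
        rw [abs_of_pos (sub_pos.2 h3)] at hs
        have h2 := hcard h3.le
        have h5 := abs_sub_le (H s) (H c) (H a)
        have h6 : |H c - H a| ≤ ε * ((c - a) + (D.filter (· < c)).card) := hPc
        change |H s - H a| ≤ _
        nlinarith
    rw [eventually_nhdsWithin_iff, Metric.eventually_nhds_iff] at hev
    obtain ⟨η, hη, hev⟩ := hev
    obtain ⟨s, hs, hcs, hsη⟩ := exists_mem_Ioo_of_sigma_eq hS hne hcB hσ.symm
      (show c < c + η by linarith)
    refine absurd (le_csSup hAb (show s ∈ A from ⟨hs, fun v hv hvs => ?_⟩)) (not_le.2 hcs)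
    rcases le_or_gt v c with h | h
    · exact hcA.2 v hv h
    · refine hev ?_ ⟨hv, h⟩
      rw [Real.dist_eq, abs_of_pos (sub_pos.2 h)]
      linarith

lemma IsDeltaAntideriv.sub_eq_sub {S : Set ℝ} (hS : IsCompact S) {f F G : ℝ → ℝ}
    (hF : IsDeltaAntideriv S f F) (hG : IsDeltaAntideriv S f G) {c d : ℝ} (hc : c ∈ S)
    (hd : d ∈ S) : F d - F c = G d - G c := by
  obtain ⟨hFc, D, hDf, hDσ, hFd⟩ := hF
  obtain ⟨hGc, E, hEf, hEσ, hGd⟩ := hG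
  have key : ∀ t ∈ S, F t + -1 * G t = F (sInf S) + -1 * G (sInf S) := fun t ht =>
    eq_of_hasDeltaDerivAt_zero hS ⟨c, hc⟩ (H := fun t => F t + -1 * G t)
      (hFc.add (continuousOn_const.mul hGc)) (hDf.union hEf).toFinset
      (fun t ht => by
        rcases (hDf.union hEf).mem_toFinset.1 ht with h | h
        exacts [hDσ t h, hEσ t h])
      (fun t ht htn => by
        rw [Finite.mem_toFinset, mem_union, not_or] at htn
        simpa using (hFd t ⟨ht, htn.1⟩).add ((hGd t ⟨ht, htn.2⟩).const_mul (-1))) ht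
  linarith [key c hc, key d hd]

/-- The delta integral of a piecewise rd-continuous function, evaluated by any antiderivative. -/
lemma deltaIntegral_eq {S : Set ℝ} (hS : IsCompact S) {f F : ℝ → ℝ}
    (hF : IsDeltaAntideriv S f F) {c d : ℝ} (hc : c ∈ S) (hd : d ∈ S) :
    deltaIntegral S f c d = F d - F c := by
  have h : ∃ F, IsDeltaAntideriv S f F := ⟨F, hF⟩
  rw [deltaIntegral, dif_pos h]
  exact h.choose_spec.sub_eq_sub hS hF hc hd

lemma PrdOn.deltaIntegral_sInf {S : Set ℝ} (hS : IsCompact S) {f : ℝ → ℝ} (hf : PrdOn S f) {t : ℝ}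
    (ht : t ∈ S) : deltaIntegral S f (sInf S) t = primitive S f t := by
  rw [deltaIntegral_eq hS (hf.isDeltaAntideriv_primitive hS ⟨t, ht⟩) (hS.sInf_mem ⟨t, ht⟩) ht,
    primitive_sInf, sub_zero]

/-- Integration by parts, for a primitive that vanishes at `max S`. -/
lemma PrdOn.primitive_mul_primitive {S : Set ℝ} (hS : IsCompact S) (hne : S.Nonempty) {f g : ℝ → ℝ}
    (hf : PrdOn S f) (hg : PrdOn S g) (h0 : primitive S g (sSup S) = 0) :
    primitive S (fun t => f t * primitive S g t) (sSup S) =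
      - primitive S (fun t => primitive S f (sigma S t) * g t) (sSup S) := by
  have hF := (hf.continuous_primitive hS hne).continuousOn (s := S)
  have hG := (hg.continuous_primitive hS hne).continuousOn (s := S)
  have h1 : PrdOn S fun t => f t * primitive S g t := hf.mul (.of_continuousOn hG)
  have h2 : PrdOn S fun t => primitive S f (sigma S t) * g t := (PrdOn.comp_sigma hS hne hF).mul hg
  have h12 := (h1.add h2).isDeltaAntideriv_primitive hS hne
  obtain ⟨-, D, hDf, hDσ, hFd⟩ := hf.isDeltaAntideriv_primitive hS hne
  obtain ⟨-, E, hEf, hEσ, hGd⟩ := hg.isDeltaAntideriv_primitive hS hne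
  have hprod : IsDeltaAntideriv S (fun t => f t * primitive S g t + primitive S f (sigma S t) * g t)
      (fun t => primitive S f t * primitive S g t) := by
    refine ⟨hF.mul hG, D ∪ E, hDf.union hEf, fun t ht => ht.elim (hDσ t) (hEσ t), ?_⟩
    rintro t ⟨ht, htn⟩
    rw [mem_union, not_or] at htn
    exact (hFd t ⟨ht, htn.1⟩).mul (hG t (kappa_subset S ht)) (hGd t ⟨ht, htn.2⟩)
  have := hprod.sub_eq_sub hS h12 (hS.sInf_mem hne) (hS.sSup_mem hne)
  simp only [h0, primitive_sInf] at this
  have hadd : primitive S (fun t => f t * primitive S g t + primitive S f (sigma S t) * g t)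
      (sSup S) = primitive S (fun t => f t * primitive S g t) (sSup S) +
        primitive S (fun t => primitive S f (sigma S t) * g t) (sSup S) :=
    intervalIntegral.integral_add (h1.intervalIntegrable hS hne _ _)
      (h2.intervalIntegrable hS hne _ _)
  linarith

lemma PrdOn.primitive_fun_sub {S : Set ℝ} (hS : IsCompact S) (hne : S.Nonempty) {f g : ℝ → ℝ}
    (hf : PrdOn S f) (hg : PrdOn S g) (t : ℝ) :
    primitive S (fun s => f s - g s) t = primitive S f t - primitive S g t :=
  intervalIntegral.integral_sub (hf.intervalIntegrable hS hne _ _)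
    (hg.intervalIntegrable hS hne _ _)

lemma primitive_const_mul (S : Set ℝ) (c : ℝ) (f : ℝ → ℝ) (t : ℝ) :
    primitive S (fun s => c * f s) t = c * primitive S f t :=
  intervalIntegral.integral_const_mul _ _

lemma PrdOn.primitive_sum {S : Set ℝ} (hS : IsCompact S) (hne : S.Nonempty) {ι : Type*}
    (s : Finset ι) {f : ι → ℝ → ℝ} (hf : ∀ i ∈ s, PrdOn S (f i)) (t : ℝ) :
    primitive S (fun x => ∑ i ∈ s, f i x) t = ∑ i ∈ s, primitive S (f i) t :=
  intervalIntegral.integral_finsetSum fun i hi => (hf i hi).intervalIntegrable hS hne _ _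

/-- If a derivative of the primitive exists at a right-dense point and agrees with the integrand,
then the integrand is continuous there: both one-sided limits must equal the derivative. -/
lemma PrdOn.continuousWithinAt_of_hasDeltaDerivAt {S : Set ℝ} (hS : IsCompact S) {f : ℝ → ℝ}
    (hf : PrdOn S f) {t : ℝ} (ht : t ∈ S) (hσ : sigma S t = t)
    (hd : HasDeltaDerivAt S (primitive S f) (f t) t) : ContinuousWithinAt f S t := by
  rw [hasDeltaDerivAt_iff_of_sigma_eq hσ, hasDerivWithinAt_iff_tendsto_slope,
    nhdsWithin_diff_singleton_eq, tendsto_sup] at hd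
  rw [continuousWithinAt_iff_left_right ht]
  constructor
  · obtain ⟨l, hl⟩ := hf.left t ht
    by_cases hnb : (𝓝[S ∩ Iio t] t).NeBot
    · rwa [tendsto_nhds_unique hd.1 (hf.tendsto_slope_left hS ht hl)]
    · rw [not_neBot.1 hnb]
      exact tendsto_bot
  · obtain ⟨l, hl⟩ := hf.right t ht
    by_cases hnb : (𝓝[S ∩ Ioi t] t).NeBot
    · rwa [tendsto_nhds_unique hd.2 (hf.tendsto_slope_right hS ht hl)]
    · rw [not_neBot.1 hnb]
      exact tendsto_bot

/-! ### Square-integral zero forces vanishing -/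

lemma PrdOn.ae_eq_zero {S : Set ℝ} (hS : IsCompact S) (hne : S.Nonempty) {w : ℝ → ℝ}
    (hw : PrdOn S w) (h0 : primitive S (fun t => w t * w t) (sSup S) = 0) :
    ∀ᵐ x, x ∈ Ioc (sInf S) (sSup S) → w (retract S x) = 0 := by
  have hle : sInf S ≤ sSup S := csInf_le hS.bddBelow (hS.sSup_mem hne)
  have hint := (hw.mul hw).intervalIntegrable hS hne (sInf S) (sSup S)
  have h1 := (intervalIntegral.integral_eq_zero_iff_of_le_of_nonneg_ae hle
    (Eventually.of_forall fun x => mul_self_nonneg (w (retract S x))) hint).1 h0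
  rw [Filter.EventuallyEq, ae_restrict_iff' measurableSet_Ioc] at h1
  filter_upwards [h1] with x hx hxI
  exact mul_self_eq_zero.1 (hx hxI)

/-- A piecewise rd-continuous function whose square has integral zero vanishes at every point of
`S^κ`, except possibly at right-dense points where it is discontinuous. -/
lemma PrdOn.eq_zero_of_primitive_sq {S : Set ℝ} (hS : IsCompact S) (hnt : S.Nontrivial) {w : ℝ → ℝ}
    (hw : PrdOn S w) (h0 : primitive S (fun t => w t * w t) (sSup S) = 0) {t : ℝ}
    (ht : t ∈ kappa S) (hc : sigma S t = t → ContinuousWithinAt w S t) : w t = 0 := by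
  have hae := hw.ae_eq_zero hS hnt.nonempty h0
  have htS := kappa_subset S ht
  have hat : sInf S ≤ t := csInf_le hS.bddBelow htS
  have hnull : ∀ u v, u < v → Ioo u v ⊆ Ioc (sInf S) (sSup S) →
      ∃ x ∈ Ioo u v, w (retract S x) = 0 := by
    intro u v huv hsub
    by_contra! hcon
    have : volume (Ioo u v) = 0 :=
      measure_mono_null (fun x hx (h : x ∈ Ioc (sInf S) (sSup S) → w (retract S x) = 0) =>
        hcon x hx (h (hsub hx))) (ae_iff.1 hae)
    rw [Real.volume_Ioo, ENNReal.ofReal_eq_zero] at this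
    linarith
  by_contra hwt
  rcases (le_csSup hS.bddAbove htS).lt_or_eq with hlt | heq
  · have hlim : Tendsto (fun x => w (retract S x)) (𝓝[>] t) (𝓝 (w t)) := by
      rcases (le_sigma hlt.le).lt_or_eq with hσ | hσ
      · refine tendsto_const_nhds.congr' ?_
        filter_upwards [Ioo_mem_nhdsGT hσ] with x hx
        rw [retract_eq_of_lt_sigma hS htS hx.1.le hx.2]
      · have := ((continuousWithinAt_iff_left_right htS).1 (hc hσ.symm)).2
        exact this.comp (tendsto_retract_right hS htS
          (neBot_right_of_sigma_eq hS hnt.nonempty hlt hσ.symm))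
    have hev := hlim.eventually_ne hwt
    obtain ⟨u, hu, hsub⟩ := mem_nhdsGT_iff_exists_Ioo_subset.1 hev
    obtain ⟨x, hx, hx0⟩ := hnull t (min u (sSup S)) (lt_min hu hlt) fun x hx =>
      ⟨hat.trans_lt hx.1, (hx.2.trans_le (min_le_right _ _)).le⟩
    exact hsub ⟨hx.1, hx.2.trans_le (min_le_left _ _)⟩ hx0
  · have hσ : sigma S t = t := by rw [heq, sigma_sSup hS]
    have hnb : (𝓝[S ∩ Iio t] t).NeBot := by
      have hacc := (lt_sigma_or_accPt hS hnt ht).resolve_left hσ.not_gt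
      rw [accPt_principal_iff_nhdsWithin] at hacc
      refine hacc.mono (nhdsWithin_mono _ fun s hs => ⟨hs.1, mem_Iio.2 ?_⟩)
      exact lt_of_le_of_ne (heq ▸ le_csSup hS.bddAbove hs.1) hs.2
    have hlim := (((continuousWithinAt_iff_left_right htS).1 (hc hσ)).1).comp
      (tendsto_retract_left hS htS hnb)
    have hev := hlim.eventually_ne hwt
    obtain ⟨u, hu, hsub⟩ := mem_nhdsLT_iff_exists_Ioo_subset.1 hev
    obtain ⟨s, hs, hus, hst⟩ := neBot_left_iff.1 hnb u hu
    obtain ⟨x, hx, hx0⟩ := hnull s t hst fun x hx =>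
      ⟨(csInf_le hS.bddBelow hs).trans_lt hx.1, hx.2.le.trans heq.le⟩
    exact hsub ⟨hus.trans hx.1, hx.2⟩ hx0

/-! ### Orthogonal projection -/

lemma PrdOn.memLp {S : Set ℝ} (hS : IsCompact S) (hne : S.Nonempty) {f : ℝ → ℝ}
    (hf : PrdOn S f) :
    MemLp (fun x => f (retract S x)) 2 (volume.restrict (Ioc (sInf S) (sSup S))) := by
  obtain ⟨M, hM⟩ := hf.exists_bound hS
  exact MemLp.of_bound (hf.measurable_comp_retract hS hne).aestronglyMeasurable M
    (Eventually.of_forall fun x => hM _ (retract_mem hS hne x))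

lemma inner_toLp {S : Set ℝ} (hS : IsCompact S) (hne : S.Nonempty) {f g : ℝ → ℝ}
    (hf : PrdOn S f) (hg : PrdOn S g) :
    inner ℝ ((hf.memLp hS hne).toLp _) ((hg.memLp hS hne).toLp _) =
      primitive S (fun t => f t * g t) (sSup S) := by
  rw [L2.inner_def, primitive,
    intervalIntegral.integral_of_le (csInf_le hS.bddBelow (hS.sSup_mem hne))]
  refine integral_congr_ae ?_
  filter_upwards [(hf.memLp hS hne).coeFn_toLp, (hg.memLp hS hne).coeFn_toLp] with x h1 h2
  rw [h1, h2]
  simp [mul_comm]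

/-- Orthogonal projection onto the span of finitely many piecewise rd-continuous functions. -/
lemma exists_orthogonal {S : Set ℝ} (hS : IsCompact S) (hne : S.Nonempty) {ι : Type*} [Fintype ι]
    {p : ι → ℝ → ℝ} (hp : ∀ i, PrdOn S (p i)) {G : ℝ → ℝ} (hG : PrdOn S G) :
    ∃ d : ι → ℝ, ∀ j,
      primitive S (fun t => p j t * (G t - ∑ i, d i * p i t)) (sSup S) = 0 := by
  set u : ι → Lp ℝ 2 (volume.restrict (Ioc (sInf S) (sSup S))) :=
    fun i => ((hp i).memLp hS hne).toLp _ with hu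
  set g := (hG.memLp hS hne).toLp _ with hg
  set K := Submodule.span ℝ (range u)
  have : FiniteDimensional ℝ K := FiniteDimensional.span_of_finite ℝ (finite_range u)
  obtain ⟨d, hd⟩ := (Submodule.mem_span_range_iff_exists_fun ℝ).1 (K.starProjection_apply_mem g)
  refine ⟨d, fun j => ?_⟩
  have hj : inner ℝ (u j) (g - K.starProjection g) = 0 :=
    (Submodule.mem_orthogonal K _).1 (K.sub_starProjection_mem_orthogonal g) _
      (Submodule.subset_span (mem_range_self j))
  rw [← hd, inner_sub_right, inner_sum] at hj
  have hjg : inner ℝ (u j) g = primitive S (fun t => p j t * G t) (sSup S) :=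
    inner_toLp hS hne (hp j) hG
  have hju : ∀ i, inner ℝ (u j) (u i) = primitive S (fun t => p j t * p i t) (sSup S) :=
    fun i => inner_toLp hS hne (hp j) (hp i)
  simp only [real_inner_smul_right, hjg, hju] at hj
  have hsum : PrdOn S fun t => ∑ i, d i * (p j t * p i t) :=
    PrdOn.sum _ fun i _ => ((hp j).mul (hp i)).const_mul _
  have h1 : (fun t => p j t * (G t - ∑ i, d i * p i t)) =
      fun t => p j t * G t - ∑ i, d i * (p j t * p i t) := by
    ext t
    rw [mul_sub, Finset.mul_sum]
    congr 1
    exact Finset.sum_congr rfl fun i _ => by ring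
  rw [h1, ((hp j).mul hG).primitive_fun_sub hS hne hsum, PrdOn.primitive_sum hS hne _
    fun i _ => ((hp j).mul (hp i)).const_mul _]
  simp only [primitive_const_mul]
  exact hj

/-! ### Iterated integrals -/

lemma PrdOn.deltaIntegral_sigma {S : Set ℝ} (hS : IsCompact S) (hne : S.Nonempty) {f : ℝ → ℝ}
    (hf : PrdOn S f) (t : ℝ) :
    deltaIntegral S f (sInf S) (sigma S t) = primitive S f (sigma S t) :=
  hf.deltaIntegral_sInf hS (sigma_mem hS hne t)

lemma PrdOn.iterIntegral {S : Set ℝ} (hS : IsCompact S) (hne : S.Nonempty) {f : ℝ → ℝ}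
    (hf : PrdOn S f) (k : ℕ) : PrdOn S (iterIntegral S f k) := by
  induction k with
  | zero => exact hf
  | succ k ih =>
    simp only [TimeScale.iterIntegral, ih.deltaIntegral_sigma hS hne]
    exact PrdOn.comp_sigma hS hne (ih.continuous_primitive hS hne).continuousOn

lemma PrdOn.iterIntegral_succ {S : Set ℝ} (hS : IsCompact S) (hne : S.Nonempty) {f : ℝ → ℝ}
    (hf : PrdOn S f) (k : ℕ) (t : ℝ) :
    TimeScale.iterIntegral S f (k + 1) t =
      primitive S (TimeScale.iterIntegral S f k) (sigma S t) :=
  (hf.iterIntegral hS hne k).deltaIntegral_sigma hS hne t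

/-- Each constant of integration contributes an iterated integral of the constant function `1`. -/
lemma PrdOn.iterIntegralConst_eq {S : Set ℝ} (hS : IsCompact S) (hne : S.Nonempty) {f : ℝ → ℝ}
    (hf : PrdOn S f) (c : ℕ → ℝ) (k : ℕ) (t : ℝ) :
    iterIntegralConst S f c k t = TimeScale.iterIntegral S f k t -
      ∑ j ∈ Finset.range k, (-1) ^ (k - j) * c (k - j) *
        TimeScale.iterIntegral S (fun _ => 1) j t := by
  have h1 : PrdOn S fun _ => (1 : ℝ) := .const 1
  induction k generalizing t with
  | zero => simp [iterIntegralConst, TimeScale.iterIntegral]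
  | succ k ih =>
    have hterm : ∀ j ∈ Finset.range k, PrdOn S fun t => (-1) ^ (k - j) * c (k - j) *
        TimeScale.iterIntegral S (fun _ => 1) j t := fun j _ =>
      (h1.iterIntegral hS hne j).const_mul _
    have hfun : iterIntegralConst S f c k = fun t => TimeScale.iterIntegral S f k t -
        ∑ j ∈ Finset.range k, (-1) ^ (k - j) * c (k - j) *
          TimeScale.iterIntegral S (fun _ => 1) j t := funext ih
    simp only [iterIntegralConst, hfun]
    rw [PrdOn.deltaIntegral_sigma hS hne
      ((hf.iterIntegral hS hne k).sub (PrdOn.sum _ hterm)),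
      (hf.iterIntegral hS hne k).primitive_fun_sub hS hne (PrdOn.sum _ hterm),
      PrdOn.primitive_sum hS hne _ hterm, ← hf.iterIntegral_succ hS hne, Finset.sum_range_succ',
      sub_sub]
    congr 2
    · refine Finset.sum_congr rfl fun j _ => ?_
      rw [primitive_const_mul, ← h1.iterIntegral_succ hS hne, Nat.add_sub_add_right]
    · simp [TimeScale.iterIntegral]

lemma PrdOn.iterate_primitive {S : Set ℝ} (hS : IsCompact S) (hne : S.Nonempty) {w : ℝ → ℝ}
    (hw : PrdOn S w) (l : ℕ) : PrdOn S ((primitive S)^[l] w) := by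
  induction l with
  | zero => exact hw
  | succ l ih =>
    rw [Function.iterate_succ_apply']
    exact .of_continuousOn (ih.continuous_primitive hS hne).continuousOn

/-- Repeated integration by parts. -/
lemma PrdOn.primitive_mul_iterate {S : Set ℝ} (hS : IsCompact S) (hne : S.Nonempty) {f w : ℝ → ℝ}
    (hf : PrdOn S f) (hw : PrdOn S w) (l m : ℕ)
    (h0 : ∀ i < l, (primitive S)^[i + 1] w (sSup S) = 0) :
    primitive S (fun t => TimeScale.iterIntegral S f m t * (primitive S)^[l] w t) (sSup S) =
      (-1) ^ l * primitive S (fun t => TimeScale.iterIntegral S f (m + l) t * w t) (sSup S) := by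
  induction l generalizing m with
  | zero => simp
  | succ l ih =>
    have h1 := h0 l (Nat.lt_succ_self l)
    rw [Function.iterate_succ_apply'] at h1
    simp only [Function.iterate_succ_apply']
    rw [(hf.iterIntegral hS hne m).primitive_mul_primitive hS hne
      (hw.iterate_primitive hS hne l) h1]
    simp only [← hf.iterIntegral_succ hS hne]
    rw [ih (m + 1) fun i hi => h0 i (hi.trans (Nat.lt_succ_self l)),
      show m + 1 + l = m + (l + 1) by ring]
    ring

/-- If `w` is orthogonal to the iterated integrals of `1` of order less than `r`, then its iterated
primitives of order `1, …, r` vanish at `max S`. -/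
lemma PrdOn.iterate_primitive_sSup {S : Set ℝ} (hS : IsCompact S) (hne : S.Nonempty) {w : ℝ → ℝ}
    (hw : PrdOn S w) {r : ℕ} (h : ∀ j < r, primitive S
      (fun t => TimeScale.iterIntegral S (fun _ => 1) j t * w t) (sSup S) = 0) {i : ℕ}
    (hi : i < r) : (primitive S)^[i + 1] w (sSup S) = 0 := by
  induction i using Nat.strong_induction_on with
  | _ i ih =>
    have := (PrdOn.const (S := S) 1).primitive_mul_iterate hS hne hw i 0
      fun k hk => ih k hk (hk.trans hi)
    rw [zero_add, h i hi, mul_zero] at this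
    rw [Function.iterate_succ_apply']
    simpa [TimeScale.iterIntegral] using this

/-! ### The first variation of the functional -/

/-- A function on `ℝⁿ` with continuous partial derivatives is differentiable. -/
lemma hasFDerivAt_of_continuous_partials {n : ℕ} {f : (Fin n → ℝ) → ℝ}
    {g : Fin n → (Fin n → ℝ) → ℝ}
    (hd : ∀ i u, HasDerivAt (fun s => f (Function.update u i s)) (g i u) (u i))
    (hc : ∀ i, Continuous (g i)) (u : Fin n → ℝ) :
    HasFDerivAt f (∑ i, g i u • (ContinuousLinearMap.proj i : (Fin n → ℝ) →L[ℝ] ℝ)) u := by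
  induction n with
  | zero =>
    have : f = fun _ => f u := funext fun v => congrArg f (Subsingleton.elim _ _)
    rw [this]
    simpa using hasFDerivAt_const (f u) u
  | succ n ih =>
    have htail : ∀ x v, HasFDerivAt (fun v : Fin n → ℝ => f (Fin.cons x v : Fin (n + 1) → ℝ))
        (∑ i : Fin n, g i.succ (Fin.cons x v : Fin (n + 1) → ℝ) •
          (ContinuousLinearMap.proj i : (Fin n → ℝ) →L[ℝ] ℝ)) v := by
      intro x v
      refine ih (f := fun v : Fin n → ℝ => f (Fin.cons x v : Fin (n + 1) → ℝ))
        (g := fun i v => g i.succ (Fin.cons x v : Fin (n + 1) → ℝ)) (fun i v => ?_) (fun i => ?_) v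
      · have := hd i.succ (Fin.cons x v : Fin (n + 1) → ℝ)
        simpa only [← Fin.cons_update, Fin.cons_succ] using this
      · exact (hc i.succ).comp (by fun_prop)
    have hhead : ∀ x v, HasFDerivAt (fun x : ℝ => f (Fin.cons x v : Fin (n + 1) → ℝ))
        (g 0 (Fin.cons x v : Fin (n + 1) → ℝ) • ContinuousLinearMap.id ℝ ℝ) x := by
      intro x v
      have := (hd 0 (Fin.cons x v : Fin (n + 1) → ℝ)).hasFDerivAt
      simp only [Fin.update_cons_zero, Fin.cons_zero] at this
      have heq : ContinuousLinearMap.toSpanSingleton ℝ (g 0 (Fin.cons x v : Fin (n + 1) → ℝ)) =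
          g 0 (Fin.cons x v : Fin (n + 1) → ℝ) • ContinuousLinearMap.id ℝ ℝ := by
        ext
        simp
      rwa [heq] at this
    have hcons : Continuous fun p : ℝ × (Fin n → ℝ) => (Fin.cons p.1 p.2 : Fin (n + 1) → ℝ) := by
      fun_prop
    have hc₁ : Continuous fun p : ℝ × (Fin n → ℝ) =>
        g 0 (Fin.cons p.1 p.2 : Fin (n + 1) → ℝ) • ContinuousLinearMap.id ℝ ℝ :=
      ((hc 0).comp hcons).smul continuous_const
    have hc₂ : Continuous fun p : ℝ × (Fin n → ℝ) =>
        ∑ i : Fin n, g i.succ (Fin.cons p.1 p.2 : Fin (n + 1) → ℝ) •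
          (ContinuousLinearMap.proj i : (Fin n → ℝ) →L[ℝ] ℝ) :=
      continuous_finsetSum _ fun i _ => ((hc i.succ).comp hcons).smul continuous_const
    have huncurry := hasStrictFDerivAt_uncurry_coprod (𝕜 := ℝ)
      (u := ((u 0, Fin.tail u) : ℝ × (Fin n → ℝ)))
      (f := fun (x : ℝ) (v : Fin n → ℝ) => f (Fin.cons x v : Fin (n + 1) → ℝ))
      (f₁ := fun x v => g 0 (Fin.cons x v : Fin (n + 1) → ℝ) • ContinuousLinearMap.id ℝ ℝ)
      (f₂ := fun x v => ∑ i : Fin n, g i.succ (Fin.cons x v : Fin (n + 1) → ℝ) •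
          (ContinuousLinearMap.proj i : (Fin n → ℝ) →L[ℝ] ℝ))
      (Eventually.of_forall fun p => hhead p.1 p.2) (Eventually.of_forall fun p => htail p.1 p.2)
      hc₁.continuousAt hc₂.continuousAt
    have hsplit : HasFDerivAt (fun v : Fin (n + 1) → ℝ => ((v 0, Fin.tail v) : ℝ × (Fin n → ℝ)))
        ((ContinuousLinearMap.proj 0 : (Fin (n + 1) → ℝ) →L[ℝ] ℝ).prod
          (ContinuousLinearMap.pi fun i : Fin n =>
            (ContinuousLinearMap.proj i.succ : (Fin (n + 1) → ℝ) →L[ℝ] ℝ))) u :=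
      ((ContinuousLinearMap.proj 0 : (Fin (n + 1) → ℝ) →L[ℝ] ℝ).prod
        (ContinuousLinearMap.pi fun i : Fin n =>
          (ContinuousLinearMap.proj i.succ : (Fin (n + 1) → ℝ) →L[ℝ] ℝ))).hasFDerivAt
    have hcomp := HasFDerivAt.comp u huncurry.hasFDerivAt hsplit
    refine (hcomp.congr_of_eventuallyEq (Eventually.of_forall fun v => ?_)).congr_fderiv ?_
    · simp [Function.HasUncurry.uncurry, Fin.cons_self_tail]
    · ext v
      simp [Function.HasUncurry.uncurry, Fin.sum_univ_succ, Fin.cons_self_tail]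

/-- Differentiation of the integrand along a line. -/
lemma HasContinuousPartials.hasDerivAt_line {K : Set ℝ} {n : ℕ} {L : ℝ → (Fin n → ℝ) → ℝ}
    (hL : HasContinuousPartials K L) {t : ℝ} (ht : t ∈ K) (u h : Fin n → ℝ) (ε : ℝ) :
    HasDerivAt (fun ε : ℝ => L t (u + ε • h)) (∑ i, partialDeriv L i t (u + ε • h) * h i) ε := by
  have hf := hasFDerivAt_of_continuous_partials (f := L t) (g := fun i v => partialDeriv L i t v)
    (fun i v => ((hL i).1 t ht v).hasDerivAt)
    (fun i => by
      rw [← continuousOn_univ]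
      exact (hL i).2.comp (Continuous.continuousOn (by fun_prop : Continuous fun v => (t, v)))
        fun v _ => ⟨ht, mem_univ _⟩)
    (u + ε • h)
  have hline : HasDerivAt (fun ε : ℝ => u + ε • h) h ε := by
    simpa using ((hasDerivAt_id ε).smul_const h).const_add u
  refine (hf.comp_hasDerivAt ε hline).congr_deriv ?_
  simp

lemma isCompact_kappa {S : Set ℝ} (hS : IsCompact S) : IsCompact (kappa S) := by
  rw [kappa_eq hS]
  exact hS.inter_right isClosed_Iic

/-- Differentiation under the integral sign: the Gateaux derivative of the functional in the
direction `H`. -/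
lemma hasDerivAt_primitive_line {S : Set ℝ} (hS : IsCompact S) (hne : S.Nonempty) {n : ℕ}
    {L : ℝ → (Fin n → ℝ) → ℝ} (hL : HasContinuousPartials (kappa S) L) {Y H : ℝ → Fin n → ℝ}
    (hY : ∀ i, PrdOn S fun t => Y t i) (hH : ∀ i, PrdOn S fun t => H t i)
    (hLine : ∀ ε : ℝ, PrdOn S fun t => L t (Y t + ε • H t)) :
    HasDerivAt (fun ε : ℝ => primitive S (fun t => L t (Y t + ε • H t)) (sSup S))
      (primitive S (fun t => ∑ i, partialDeriv L i t (Y t) * H t i) (sSup S)) 0 := by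
  have hle : sInf S ≤ sSup S := csInf_le hS.bddBelow (hS.sSup_mem hne)
  -- `x` in the interior of the interval of integration retracts into `S^κ`
  have hret : ∀ᵐ x, x ∈ uIoc (sInf S) (sSup S) → retract S x ∈ kappa S := by
    have h0 : ({sSup S} : Set ℝ)ᶜ ∈ ae (volume : Measure ℝ) := compl_mem_ae_iff.2 (by simp)
    filter_upwards [h0] with x hx hxI
    rw [uIoc_of_le hle] at hxI
    refine mem_kappa_of_lt hS (retract_mem hS hne x) ?_
    exact (retract_le hS hne hxI.1.le).trans_lt (lt_of_le_of_ne hxI.2 hx)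
  have hbd : ∀ u : ℝ → Fin n → ℝ, (∀ i, PrdOn S fun t => u t i) →
      ∃ M, 0 ≤ M ∧ ∀ t ∈ S, ‖u t‖ ≤ M := by
    intro u hu
    choose M hM using fun i => (hu i).exists_bound hS
    refine ⟨∑ i, |M i|, Finset.sum_nonneg fun i _ => abs_nonneg _, fun t ht => ?_⟩
    refine (pi_norm_le_iff_of_nonneg (Finset.sum_nonneg fun i _ => abs_nonneg _)).2 fun i => ?_
    exact ((hM i t ht).trans (le_abs_self _)).trans
      (Finset.single_le_sum (f := fun i => |M i|) (fun i _ => abs_nonneg _) (Finset.mem_univ i))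
  obtain ⟨M, hM0, hM⟩ := hbd Y hY
  obtain ⟨N, hN0, hN⟩ := hbd H hH
  have hC : ∀ i, ∃ C, ∀ p ∈ kappa S ×ˢ Metric.closedBall (0 : Fin n → ℝ) (M + N),
      ‖partialDeriv L i p.1 p.2‖ ≤ C := fun i =>
    ((isCompact_kappa hS).prod (isCompact_closedBall _ _)).exists_bound_of_continuousOn
      ((hL i).2.mono (prod_mono subset_rfl (subset_univ _)))
  choose C hC using hC
  have hF' : PrdOn S fun t => ∑ i, partialDeriv L i t (Y t) * H t i :=
    PrdOn.sum _ fun i _ => ((prdOn_kappa_iff hS).1 (PrdOn.comp (hL i).2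
      fun i => (prdOn_kappa_iff hS).2 (hY i))).mul (hH i)
  refine (intervalIntegral.hasDerivAt_integral_of_dominated_loc_of_deriv_le (𝕜 := ℝ)
    (F := fun ε x => L (retract S x) (Y (retract S x) + ε • H (retract S x)))
    (F' := fun ε x => ∑ i, partialDeriv L i (retract S x) (Y (retract S x) + ε • H (retract S x))
      * H (retract S x) i)
    (bound := fun _ => ∑ i, C i * N) (s := Metric.ball 0 1)
    (Metric.ball_mem_nhds 0 one_pos) ?_ ?_ ?_ ?_ ?_ ?_).2.congr_deriv ?_
  · exact Eventually.of_forall fun ε =>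
      ((hLine ε).measurable_comp_retract hS hne).aestronglyMeasurable
  · exact (hLine 0).intervalIntegrable hS hne _ _
  · simp only [zero_smul, add_zero]
    exact (hF'.measurable_comp_retract hS hne).aestronglyMeasurable
  · filter_upwards [hret] with x hx hxI ε hε
    have htS := retract_mem hS hne x
    refine (norm_sum_le _ _).trans (Finset.sum_le_sum fun i _ => ?_)
    rw [norm_mul]
    have hp := hC i (retract S x, Y (retract S x) + ε • H (retract S x)) ⟨hx hxI, by
      rw [mem_closedBall_zero_iff]
      refine (norm_add_le _ _).trans (add_le_add (hM _ htS) ?_)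
      rw [norm_smul]
      have : ‖ε‖ ≤ 1 := (mem_ball_zero_iff.1 hε).le
      exact (mul_le_mul this (hN _ htS) (norm_nonneg _) zero_le_one).trans_eq (one_mul _)⟩
    exact mul_le_mul hp ((norm_le_pi_norm _ i).trans (hN _ htS)) (norm_nonneg _)
      ((norm_nonneg _).trans hp)
  · exact intervalIntegrable_const
  · filter_upwards [hret] with x hx hxI ε _
    exact hL.hasDerivAt_line (hx hxI) _ _ _
  · simp only [zero_smul, add_zero]
    rfl

/-! ### The time scales `T^{κ^n}` -/

lemma kappaIter_succ (T : Set ℝ) (n : ℕ) : kappaIter T (n + 1) = kappa (kappaIter T n) :=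
  Function.iterate_succ_apply' _ _ _

lemma sSup_inter_Iic {T : Set ℝ} {c : ℝ} (hc : c ∈ T) : sSup (T ∩ Iic c) = c :=
  IsGreatest.csSup_eq ⟨⟨hc, self_mem_Iic⟩, fun _ hs => hs.2⟩

lemma sInf_inter_Iic {T : Set ℝ} (hT : IsCompact T) {c : ℝ} (hc : c ∈ T) :
    sInf (T ∩ Iic c) = sInf T :=
  IsLeast.csInf_eq ⟨⟨hT.sInf_mem ⟨c, hc⟩, csInf_le hT.bddBelow hc⟩,
    fun _ hs => csInf_le hT.bddBelow hs.1⟩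

lemma sigma_inter_Iic {T : Set ℝ} (hT : IsCompact T) {c : ℝ} (hc : c ∈ T) {t : ℝ} (ht : t < c) :
    sigma (T ∩ Iic c) t = sigma T t := by
  have hS : IsCompact (T ∩ Iic c) := hT.inter_right isClosed_Iic
  have h1 : {s ∈ T ∩ Iic c | t < s}.Nonempty := ⟨c, ⟨hc, self_mem_Iic⟩, ht⟩
  have h2 : {s ∈ T | t < s}.Nonempty := ⟨c, hc, ht⟩
  refine le_antisymm ?_ ?_
  · rw [sigma.eq_def T, if_pos h2]
    refine le_csInf h2 fun s hs => ?_
    rcases le_total s c with h | h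
    · exact sigma_le hS ⟨hs.1, h⟩ hs.2
    · exact (sigma_le hS ⟨hc, self_mem_Iic⟩ ht).trans h
  · rw [sigma.eq_def (T ∩ Iic c), if_pos h1]
    exact le_csInf h1 fun s hs => sigma_le hT hs.1.1 hs.2

lemma rho_inter_Iic {T : Set ℝ} (hT : IsCompact T) {c : ℝ} (hc : c ∈ T) :
    rho (T ∩ Iic c) c = rho T c := by
  have : {s ∈ T ∩ Iic c | s < c} = {s ∈ T | s < c} := by
    ext s
    exact ⟨fun h => ⟨h.1.1, h.2⟩, fun h => ⟨⟨h.1, h.2.le⟩, h.2⟩⟩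
  rw [rho, rho, this, sInf_inter_Iic hT hc]

lemma iterate_rho_mem {T : Set ℝ} (hT : IsCompact T) (hne : T.Nonempty) (n : ℕ) :
    (rho T)^[n] (sSup T) ∈ T := by
  induction n with
  | zero => exact hT.sSup_mem hne
  | succ n ih =>
    rw [Function.iterate_succ_apply']
    exact rho_mem hT hne _

lemma kappaIter_eq {T : Set ℝ} (hT : IsCompact T) (hne : T.Nonempty) (n : ℕ) :
    kappaIter T n = T ∩ Iic ((rho T)^[n] (sSup T)) := by
  induction n with
  | zero =>
    ext s
    exact ⟨fun h => ⟨h, le_csSup hT.bddAbove h⟩, fun h => h.1⟩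
  | succ n ih =>
    have hc := iterate_rho_mem hT hne n
    rw [kappaIter_succ, ih, kappa_eq (hT.inter_right isClosed_Iic), sSup_inter_Iic hc,
      rho_inter_Iic hT hc, Function.iterate_succ_apply', inter_assoc, Iic_inter_Iic,
      min_eq_right (rho_le (csInf_le hT.bddBelow hc))]

lemma isCompact_kappaIter {T : Set ℝ} (hT : IsCompact T) (hne : T.Nonempty) (n : ℕ) :
    IsCompact (kappaIter T n) := by
  rw [kappaIter_eq hT hne]
  exact hT.inter_right isClosed_Iic

lemma sSup_kappaIter {T : Set ℝ} (hT : IsCompact T) (hne : T.Nonempty) (n : ℕ) :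
    sSup (kappaIter T n) = (rho T)^[n] (sSup T) := by
  rw [kappaIter_eq hT hne, sSup_inter_Iic (iterate_rho_mem hT hne n)]

lemma sInf_kappaIter {T : Set ℝ} (hT : IsCompact T) (hne : T.Nonempty) (n : ℕ) :
    sInf (kappaIter T n) = sInf T := by
  rw [kappaIter_eq hT hne, sInf_inter_Iic hT (iterate_rho_mem hT hne n)]

lemma kappaIter_antitone (T : Set ℝ) : Antitone (kappaIter T) :=
  antitone_nat_of_succ_le fun n => by
    rw [kappaIter_succ]
    exact kappa_subset _

lemma encard_le_kappa {S : Set ℝ} (hS : IsCompact S) : S.encard ≤ (kappa S).encard + 1 := by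
  have hsub : S ⊆ insert (sSup S) (kappa S) := by
    intro s hs
    rcases (le_csSup hS.bddAbove hs).lt_or_eq with h | h
    · exact mem_insert_of_mem _ (mem_kappa_of_lt hS hs h)
    · exact h ▸ mem_insert _ _
  exact (encard_le_encard hsub).trans (encard_insert_le _ _)

lemma nontrivial_kappaIter {T : Set ℝ} (hT : IsCompact T) (hne : T.Nonempty) {n : ℕ}
    (h : ((n + 2 : ℕ) : ℕ∞) ≤ T.encard) : (kappaIter T n).Nontrivial := by
  have key : ∀ m, T.encard ≤ (kappaIter T m).encard + m := by
    intro m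
    induction m with
    | zero => simp [kappaIter]
    | succ m ih =>
      refine ih.trans ?_
      rw [kappaIter_succ, Nat.cast_succ, add_comm (m : ℕ∞) 1, ← add_assoc]
      exact add_le_add_left (encard_le_kappa (isCompact_kappaIter hT hne m)) _
  rw [← one_lt_encard_iff_nontrivial]
  have h2 := h.trans (key n)
  by_contra! hcon
  have h3 : ((n + 2 : ℕ) : ℕ∞) ≤ ((1 + n : ℕ) : ℕ∞) := by
    push_cast at h2 ⊢
    exact h2.trans (add_le_add_left hcon _)
  have := Nat.cast_le.1 h3
  omega

lemma nhdsWithin_kappa_eq {S : Set ℝ} (hS : IsCompact S) {t : ℝ} (ht : t ∈ kappa S) :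
    𝓝[kappa S] t = 𝓝[S] t := by
  rcases (le_csSup hS.bddAbove (kappa_subset S ht)).lt_or_eq with h | h
  · simpa using nhdsWithin_kappa_inter hS h univ
  · rw [kappa_eq hS] at ht ⊢
    rw [inter_eq_left.2]
    exact fun s hs => (le_csSup hS.bddAbove hs).trans (h.symm.le.trans ht.2)

/-! ### Systems of iterated delta derivatives -/

lemma deltaDeriv_congr {S : Set ℝ} (hS : IsCompact S) (hnt : S.Nontrivial) {f g : ℝ → ℝ}
    (hfg : EqOn f g S) {t : ℝ} (ht : t ∈ kappa S) : deltaDeriv S f t = deltaDeriv S g t := by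
  have hσ := sigma_mem hS hnt.nonempty t
  by_cases h : DeltaDifferentiableAt S f t
  · exact (deltaDeriv_eq hS hnt ht (h.hasDeltaDerivAt.congr hσ hfg)).symm
  · have h' : ¬ DeltaDifferentiableAt S g t := fun ⟨d, hd⟩ => h ⟨d, hd.congr hσ hfg.symm⟩
    rw [deltaDeriv, deltaDeriv, dif_neg h, dif_neg h']

lemma deltaDeriv_const_mul {S : Set ℝ} (hS : IsCompact S) (hnt : S.Nontrivial) {f : ℝ → ℝ} (c : ℝ)
    {t : ℝ} (ht : t ∈ kappa S) : deltaDeriv S (fun s => c * f s) t = c * deltaDeriv S f t := by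
  by_cases h : DeltaDifferentiableAt S f t
  · exact deltaDeriv_eq hS hnt ht (h.hasDeltaDerivAt.const_mul c)
  rcases eq_or_ne c 0 with rfl | hc
  · refine deltaDeriv_eq hS hnt ht fun ε hε => ⟨univ, univ_mem, fun s _ => ?_⟩
    simp only [zero_mul, sub_zero, abs_zero]
    positivity
  · have h' : ¬ DeltaDifferentiableAt S (fun s => c * f s) t := by
      rintro ⟨d, hd⟩
      have := hd.const_mul c⁻¹
      simp only [inv_mul_cancel_left₀ hc] at this
      exact h ⟨_, this⟩
    rw [deltaDeriv, deltaDeriv, dif_neg h, dif_neg h', mul_zero]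

lemma iterDeltaDeriv_const_mul {T : Set ℝ} (hT : IsCompact T) (hne : T.Nonempty) (f : ℝ → ℝ)
    (c : ℝ) (n : ℕ) (hnt : ∀ i < n, (kappaIter T i).Nontrivial) :
    EqOn (iterDeltaDeriv T n fun s => c * f s) (fun s => c * iterDeltaDeriv T n f s)
      (kappaIter T n) := by
  induction n with
  | zero => exact fun _ _ => rfl
  | succ n ih =>
    intro t ht
    rw [kappaIter_succ] at ht
    have hn := hnt n (Nat.lt_succ_self n)
    have hK := isCompact_kappaIter hT hne n
    simp only [iterDeltaDeriv]
    rw [deltaDeriv_congr hK hn (ih fun i hi => hnt i (hi.trans (Nat.lt_succ_self n))) ht,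
      deltaDeriv_const_mul hK hn c ht]

/-- A system `u 0, …, u r` in which every function is the delta derivative of the preceding one, the
last one up to a finite set `E` of right-dense points.  Such a system describes a function `u 0` of
class `C_prd^r` together with its delta derivatives. -/
structure DeltaJet (T : Set ℝ) (r : ℕ) (u : ℕ → ℝ → ℝ) (E : Set ℝ) : Prop where
  deriv : ∀ i, i + 1 < r → ∀ t ∈ kappaIter T (i + 1),
    HasDeltaDerivAt (kappaIter T i) (u i) (u (i + 1) t) t
  cont : ∀ i < r, ContinuousOn (u i) (kappaIter T i)
  finite : E.Finite
  dense : ∀ t ∈ E, sigma (kappaIter T (r - 1)) t = t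
  top : ∀ t ∈ kappaIter T r \ E, HasDeltaDerivAt (kappaIter T (r - 1)) (u (r - 1)) (u r t) t
  prd : PrdOn (kappaIter T r) (u r)

lemma Cprd.deltaJet {T : Set ℝ} (hT : IsCompact T) (hne : T.Nonempty) {r : ℕ} (hr : 1 ≤ r)
    {y : ℝ → ℝ} (hy : Cprd T r y) (hntr : (kappaIter T r).Nonempty) :
    DeltaJet T r (fun i => iterDeltaDeriv T i y) {t ∈ kappaIter T r |
      ¬ DeltaDifferentiableAt (kappaIter T (r - 1)) (iterDeltaDeriv T (r - 1) y) t} where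
  deriv i hi t ht := (hy.exists_deriv i hi t ht).hasDeltaDerivAt
  cont := hy.continuousOn
  finite := hy.exists_top
  dense t ht := by
    have htS : t ∈ kappaIter T (r - 1) := kappaIter_antitone T (Nat.sub_le r 1) ht.1
    by_contra hσ
    -- at a right-scattered point continuity suffices for differentiability
    have hlt : t < sigma (kappaIter T (r - 1)) t := lt_of_le_of_ne
      (le_sigma (le_csSup (isCompact_kappaIter hT hne _).bddAbove htS)) (Ne.symm hσ)
    exact ht.2 ⟨_, hasDeltaDerivAt_of_lt_sigma hlt (hy.continuousOn (r - 1) (by omega) t htS)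
      (div_mul_cancel₀ _ (sub_ne_zero.2 hlt.ne')).symm⟩
  top := by
    rintro t ⟨ht, htE⟩
    have hd : DeltaDifferentiableAt (kappaIter T (r - 1)) (iterDeltaDeriv T (r - 1) y) t := by
      by_contra hcon
      exact htE ⟨ht, hcon⟩
    obtain ⟨k, rfl⟩ : ∃ k, r = k + 1 := ⟨r - 1, by omega⟩
    exact hd.hasDeltaDerivAt
  prd := (piecewiseRdContinuous_iff (isCompact_kappaIter hT hne r) hntr).1 hy.piecewise_top

namespace DeltaJet

lemma add_const_mul {T : Set ℝ} {r : ℕ} {u v : ℕ → ℝ → ℝ} {E F : Set ℝ} (hu : DeltaJet T r u E)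
    (hv : DeltaJet T r v F) (ε : ℝ) : DeltaJet T r (fun i t => u i t + ε * v i t) (E ∪ F) where
  deriv i hi t ht := (hu.deriv i hi t ht).add ((hv.deriv i hi t ht).const_mul ε)
  cont i hi := (hu.cont i hi).add (continuousOn_const.mul (hv.cont i hi))
  finite := hu.finite.union hv.finite
  dense t ht := ht.elim (hu.dense t) (hv.dense t)
  top t ht := (hu.top t ⟨ht.1, fun h => ht.2 (Or.inl h)⟩).add
    ((hv.top t ⟨ht.1, fun h => ht.2 (Or.inr h)⟩).const_mul ε)
  prd := hu.prd.add (hv.prd.const_mul ε)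

lemma iterDeltaDeriv_eqOn {T : Set ℝ} (hT : IsCompact T) (hne : T.Nonempty) {r : ℕ}
    {u : ℕ → ℝ → ℝ} {E : Set ℝ} (hu : DeltaJet T r u E)
    (hnt : ∀ i < r, (kappaIter T i).Nontrivial) {i : ℕ} (hi : i < r) :
    EqOn (iterDeltaDeriv T i (u 0)) (u i) (kappaIter T i) := by
  induction i with
  | zero => exact fun _ _ => rfl
  | succ i ih =>
    intro t ht
    have hi' := (Nat.lt_succ_self i).trans hi
    have hK := isCompact_kappaIter hT hne i
    have hd := hu.deriv i hi t ht
    rw [kappaIter_succ] at ht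
    simp only [iterDeltaDeriv]
    rw [deltaDeriv_congr hK (hnt i hi') (ih hi') ht]
    exact deltaDeriv_eq hK (hnt i hi') ht hd

lemma hasDeltaDerivAt_top {T : Set ℝ} (hT : IsCompact T) (hne : T.Nonempty) {r : ℕ} (hr : 1 ≤ r)
    {u : ℕ → ℝ → ℝ} {E : Set ℝ} (hu : DeltaJet T r u E)
    (hnt : ∀ i < r, (kappaIter T i).Nontrivial) {t : ℝ} (ht : t ∈ kappaIter T r \ E) :
    HasDeltaDerivAt (kappaIter T (r - 1)) (iterDeltaDeriv T (r - 1) (u 0)) (u r t) t :=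
  (hu.top t ht).congr (sigma_mem (isCompact_kappaIter hT hne _) (hnt _ (by omega)).nonempty t)
    (hu.iterDeltaDeriv_eqOn hT hne hnt (by omega)).symm

lemma iterDeltaDeriv_top {T : Set ℝ} (hT : IsCompact T) (hne : T.Nonempty) {r : ℕ} (hr : 1 ≤ r)
    {u : ℕ → ℝ → ℝ} {E : Set ℝ} (hu : DeltaJet T r u E)
    (hnt : ∀ i < r, (kappaIter T i).Nontrivial) {t : ℝ} (ht : t ∈ kappaIter T r \ E) :
    iterDeltaDeriv T r (u 0) t = u r t := by
  have hd := hu.hasDeltaDerivAt_top hT hne hr hnt ht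
  obtain ⟨k, rfl⟩ : ∃ k, r = k + 1 := ⟨r - 1, by omega⟩
  have ht' := ht.1
  rw [kappaIter_succ] at ht'
  exact deltaDeriv_eq (isCompact_kappaIter hT hne k) (hnt k (Nat.lt_succ_self k)) ht' hd

lemma cprd {T : Set ℝ} (hT : IsCompact T) (hne : T.Nonempty) {r : ℕ} (hr : 1 ≤ r)
    {u : ℕ → ℝ → ℝ} {E : Set ℝ} (hu : DeltaJet T r u E)
    (hnt : ∀ i < r, (kappaIter T i).Nontrivial) (hntr : (kappaIter T r).Nonempty) :
    Cprd T r (u 0) where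
  exists_deriv i hi t ht := ⟨u (i + 1) t, (hu.deriv i hi t ht).congr
    (sigma_mem (isCompact_kappaIter hT hne _) (hnt i (by omega)).nonempty t)
    (hu.iterDeltaDeriv_eqOn hT hne hnt (by omega)).symm⟩
  continuousOn i hi := (hu.cont i hi).congr (hu.iterDeltaDeriv_eqOn hT hne hnt hi)
  exists_top := by
    refine hu.finite.subset ?_
    rintro t ⟨ht, hn⟩
    by_contra hE
    exact hn ⟨_, hu.hasDeltaDerivAt_top hT hne hr hnt ⟨ht, hE⟩⟩
  piecewise_top := (piecewiseRdContinuous_iff (isCompact_kappaIter hT hne r) hntr).2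
    (hu.prd.congr_off_finite hu.finite fun t ht => (hu.iterDeltaDeriv_top hT hne hr hnt ht).symm)

end DeltaJet

/-! ### Variations with vanishing boundary values -/

/-- Extension by zero beyond `B` preserves delta derivatives, provided that both the function and
its derivative vanish at `B`. -/
lemma hasDeltaDerivAt_extend {T : Set ℝ} (hT : IsCompact T) {B : ℝ} (hB : B ∈ T) {g : ℝ → ℝ}
    (hg : Continuous g) (hgB : g B = 0) (hGB : primitive (T ∩ Iic B) g B = 0) {t : ℝ}
    (ht : t ∈ T) :
    HasDeltaDerivAt T (fun s => if s ≤ B then primitive (T ∩ Iic B) g s else 0)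
      (if t ≤ B then g t else 0) t := by
  set S := T ∩ Iic B with hSdef
  have hS : IsCompact S := hT.inter_right isClosed_Iic
  have hBS : B ∈ S := ⟨hB, self_mem_Iic⟩
  have hgS : PrdOn S g := .of_continuousOn hg.continuousOn
  have hGc : Continuous (primitive S g) := hgS.continuous_primitive hS ⟨B, hBS⟩
  set F : ℝ → ℝ := fun s => if s ≤ B then primitive S g s else 0 with hF
  have hFc : Continuous F := hGc.if_le continuous_const continuous_id continuous_const
    fun x hx => by rw [show x = B from hx, hGB]
  have hF0 : ∀ s, B ≤ s → F s = 0 := by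
    intro s hs
    rcases hs.lt_or_eq with h | h
    · exact if_neg (not_le.2 h)
    · rw [hF, ← h]
      simp [hGB]
  rcases lt_or_ge t B with htB | htB
  · rw [if_pos htB.le]
    have htS : t ∈ S := ⟨ht, htB.le⟩
    have hd := hgS.hasDeltaDerivAt_primitive hS htS fun _ => hg.continuousWithinAt
    have hnhds : 𝓝[S] t = 𝓝[T] t := nhdsWithin_inter_of_mem' (nhdsWithin_le_nhds (Iic_mem_nhds htB))
    rw [hasDeltaDerivAt_iff_isLittleO, sigma_inter_Iic hT hB htB, hnhds] at hd
    rw [hasDeltaDerivAt_iff_isLittleO]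
    refine hd.congr' ?_ EventuallyEq.rfl
    filter_upwards [nhdsWithin_le_nhds (Iic_mem_nhds htB)] with s hs
    simp only [hF]
    rw [if_pos (mem_Iic.1 hs), if_pos (sigma_le hT hB htB)]
  · have hval : (if t ≤ B then g t else 0) = 0 := by
      split_ifs with h
      · rw [le_antisymm h htB, hgB]
      · rfl
    rw [hval]
    rcases (le_sigma (le_csSup hT.bddAbove ht)).lt_or_eq with hσ | hσ
    · refine hasDeltaDerivAt_of_lt_sigma hσ hFc.continuousWithinAt ?_
      rw [hF0 _ htB, hF0 _ (htB.trans hσ.le)]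
      ring
    · rw [hasDeltaDerivAt_iff_of_sigma_eq hσ.symm]
      have hright : HasDerivWithinAt F 0 (Ici B) t :=
        (hasDerivWithinAt_const t (Ici B) (0 : ℝ)).congr (fun s hs => hF0 s hs) (hF0 t htB)
      rcases htB.lt_or_eq with hlt | rfl
      · exact (hright.hasDerivAt (Ici_mem_nhds hlt)).hasDerivWithinAt
      · have hσS : sigma S B = B := by
          have := sigma_sSup hS
          rwa [sSup_inter_Iic hB] at this
        have hleft := hgS.hasDeltaDerivAt_primitive hS hBS
          fun _ => hg.continuousWithinAt
        rw [hasDeltaDerivAt_iff_of_sigma_eq hσS, hgB] at hleft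
        have hleft' : HasDerivWithinAt F 0 S B :=
          hleft.congr (fun s hs => if_pos hs.2) (if_pos le_rfl)
        refine (hleft'.union hright).mono fun s hs => ?_
        rcases le_total s B with h | h
        · exact Or.inl ⟨hs, h⟩
        · exact Or.inr h

/-- The system of iterated primitives of `w`, numbered so that `w` is the `r`-th member, and
extended by zero beyond `max S`. -/
def variation (S : Set ℝ) (r : ℕ) (w : ℝ → ℝ) (i : ℕ) (t : ℝ) : ℝ :=
  if t ≤ sSup S then (primitive S)^[r - i] w t else 0

/-- If the iterated primitives of `w` of order `1, …, r` vanish at the right end of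
`T^{κ^{r-1}}`, then they form the system of delta derivatives of a function on `T`. -/
lemma exists_deltaJet_variation {T : Set ℝ} (hT : IsCompact T) (hne : T.Nonempty) {r : ℕ}
    (hr : 1 ≤ r) {w : ℝ → ℝ} (hw : PrdOn (kappaIter T (r - 1)) w)
    (h0 : ∀ i < r, (primitive (kappaIter T (r - 1)))^[i + 1] w (sSup (kappaIter T (r - 1))) = 0) :
    ∃ E, DeltaJet T r (variation (kappaIter T (r - 1)) r w) E := by
  set S := kappaIter T (r - 1) with hSdef
  have hS : IsCompact S := isCompact_kappaIter hT hne _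
  have hBT : sSup S ∈ T := by
    rw [hSdef, sSup_kappaIter hT hne]
    exact iterate_rho_mem hT hne _
  have hSB : S = T ∩ Iic (sSup S) := by
    rw [hSdef, sSup_kappaIter hT hne, ← kappaIter_eq hT hne]
  have hSne : S.Nonempty := by
    rw [hSB]
    exact ⟨_, hBT, self_mem_Iic⟩
  have hB : sSup S ∈ S := hS.sSup_mem hSne
  have hcont : ∀ m, Continuous ((primitive S)^[m + 1] w) := fun m => by
    rw [Function.iterate_succ_apply']
    exact (hw.iterate_primitive hS hSne m).continuous_primitive hS hSne
  obtain ⟨-, D, hDf, hDσ, hDd⟩ := hw.isDeltaAntideriv_primitive hS hSne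
  have hKr : kappaIter T r = kappa S := by
    rw [hSdef, ← kappaIter_succ, Nat.sub_add_cancel hr]
  refine ⟨D, fun i hi t ht => ?_, fun i hi => ?_, hDf, hDσ, ?_, ?_⟩
  · have hBi : sSup S ∈ kappaIter T i := kappaIter_antitone T (by omega : i ≤ r - 1) hB
    have hSi : S = kappaIter T i ∩ Iic (sSup S) := by
      refine Subset.antisymm (fun s hs => ⟨kappaIter_antitone T (by omega : i ≤ r - 1) hs,
        le_csSup hS.bddAbove hs⟩) fun s hs => ?_
      rw [hSB]
      exact ⟨kappaIter_antitone T (Nat.zero_le i) hs.1, hs.2⟩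
    obtain ⟨m, hm⟩ : ∃ m, r - (i + 1) = m + 1 := ⟨r - (i + 1) - 1, by omega⟩
    have hm' : r - i = m + 1 + 1 := by omega
    have key := hasDeltaDerivAt_extend (isCompact_kappaIter hT hne i) hBi (hcont m)
      (h0 m (by omega)) (t := t)
    rw [← hSi, ← Function.iterate_succ_apply' (primitive S) (m + 1) w] at key
    have := key (h0 (m + 1) (by omega)) (kappaIter_antitone T (Nat.le_succ i) ht)
    unfold variation
    rw [hm, hm']
    exact this
  · obtain ⟨m, hm⟩ : ∃ m, r - i = m + 1 := ⟨r - i - 1, by omega⟩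
    have : Continuous (variation S r w i) := by
      unfold variation
      rw [hm]
      exact (hcont m).if_le continuous_const continuous_id continuous_const
        fun x hx => by rw [show x = sSup S from hx, h0 m (by omega)]
    exact this.continuousOn
  · rintro t ⟨ht, htD⟩
    rw [hKr] at ht
    have htS := kappa_subset S ht
    have h1 : variation S r w r t = w t := by
      rw [variation, if_pos (le_csSup hS.bddAbove htS), Nat.sub_self]
      rfl
    rw [h1]
    refine (hDd t ⟨ht, htD⟩).congr (sigma_mem hS hSne t) fun s hs => ?_
    rw [variation, if_pos (le_csSup hS.bddAbove hs), show r - (r - 1) = 1 by omega]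
    rfl
  · rw [hKr]
    refine ((prdOn_kappa_iff hS).2 hw).congr_off_finite finite_empty fun t ht => ?_
    rw [variation, if_pos (le_csSup hS.bddAbove (kappa_subset S ht.1)), Nat.sub_self]
    rfl

/-! ### The Euler–Lagrange equation -/

lemma weakNorm_const_mul_le {T : Set ℝ} (hT : IsCompact T) (hne : T.Nonempty) {r : ℕ}
    (hnt : ∀ i < r, (kappaIter T i).Nontrivial) {η : ℝ → ℝ} {M : ℝ}
    (hM : ∀ i ≤ r, ∀ t ∈ kappaIter T r, |iterDeltaDeriv T i η t| ≤ M) (c : ℝ) :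
    weakNorm T r (fun t => c * η t) ≤ ENNReal.ofReal ((r + 1) * (|c| * M)) := by
  have h1 : ∀ i ∈ Finset.range (r + 1), ⨆ t ∈ kappaIter T r,
      ENNReal.ofReal |iterDeltaDeriv T i (fun t => c * η t) t| ≤ ENNReal.ofReal (|c| * M) := by
    intro i hi
    have hir : i ≤ r := Nat.lt_succ_iff.1 (Finset.mem_range.1 hi)
    refine iSup₂_le fun t ht => ENNReal.ofReal_le_ofReal ?_
    rw [iterDeltaDeriv_const_mul hT hne η c i (fun j hj => hnt j (hj.trans_le hir))
      (kappaIter_antitone T hir ht), abs_mul]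
    exact mul_le_mul_of_nonneg_left (hM i hir t ht) (abs_nonneg c)
  refine (Finset.sum_le_card_nsmul _ _ _ h1).trans_eq ?_
  rw [Finset.card_range, nsmul_eq_mul, ← Nat.cast_succ,
    ENNReal.ofReal_mul (p := ((r + 1 : ℕ) : ℝ)) (by positivity), ENNReal.ofReal_natCast]

/-- The components of the jet of a function of class `C_prd^r`. -/
lemma Cprd.prdOn_jet {T : Set ℝ} (hT : IsCompact T) (hne : T.Nonempty) {r : ℕ} {y : ℝ → ℝ}
    (hy : Cprd T r y) (hntr : (kappaIter T r).Nonempty) (i : Fin (r + 1)) :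
    PrdOn (kappaIter T r) fun t => jet T r y t i := by
  rcases (Nat.lt_succ_iff.1 i.2).lt_or_eq with h | h
  · exact .of_continuousOn ((hy.continuousOn i h).mono (kappaIter_antitone T h.le))
  · simp only [jet, h]
    exact (piecewiseRdContinuous_iff (isCompact_kappaIter hT hne r) hntr).1 hy.piecewise_top

/-- Vanishing of the first variation at a weak local minimizer, in the directions generated by a
function `w` whose iterated primitives vanish at the right end. -/
lemma IsWeakLocalMinimizer.primitive_eq_zero {T : Set ℝ} (hT : IsCompact T) (hne : T.Nonempty)
    {r : ℕ} (hr : 1 ≤ r) (hnt : ∀ i ≤ r, (kappaIter T i).Nontrivial)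
    {L : ℝ → (Fin (r + 1) → ℝ) → ℝ} {ya yb : Fin r → ℝ}
    (hL : HasContinuousPartials (kappaIter T r) L)
    (hL_along : ∀ z : ℝ → ℝ, Admissible T r ya yb z →
      PiecewiseRdContinuous (kappaIter T r) (fun t => L t (jet T r z t)))
    {y : ℝ → ℝ} (hy : IsWeakLocalMinimizer T r L ya yb y) {w : ℝ → ℝ}
    (hw : PrdOn (kappaIter T (r - 1)) w)
    (h0 : ∀ i < r, (primitive (kappaIter T (r - 1)))^[i + 1] w (sSup (kappaIter T (r - 1))) = 0) :
    primitive (kappaIter T (r - 1)) (fun t => ∑ i : Fin (r + 1), partialAlong T r L y i t *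
      (primitive (kappaIter T (r - 1)))^[r - i] w t) (sSup (kappaIter T (r - 1))) = 0 := by
  obtain ⟨hadm, δ, hδ, hmin⟩ := hy
  set S := kappaIter T (r - 1) with hSdef
  have hS : IsCompact S := isCompact_kappaIter hT hne _
  have hSne : S.Nonempty := (hnt (r - 1) (by omega)).nonempty
  have hKr : kappaIter T r = kappa S := by
    rw [hSdef, ← kappaIter_succ, Nat.sub_add_cancel hr]
  have hntr : (kappaIter T r).Nonempty := (hnt r le_rfl).nonempty
  have hK : IsCompact (kappaIter T r) := isCompact_kappaIter hT hne r
  have hnt' : ∀ i < r, (kappaIter T i).Nontrivial := fun i hi => hnt i hi.le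
  have haS : sInf T ∈ S := by
    rw [← sInf_kappaIter hT hne (r - 1)]
    exact hS.sInf_mem hSne
  have hBS : sSup S ∈ S := hS.sSup_mem hSne
  have hBρ : (rho T)^[r - 1] (sSup T) = sSup S := (sSup_kappaIter hT hne _).symm
  have hSsub : ∀ i < r, S ⊆ kappaIter T i := fun i hi => kappaIter_antitone T (by omega)
  obtain ⟨F, hv⟩ : ∃ F, DeltaJet T r (variation S r w) F :=
    exists_deltaJet_variation hT hne hr hw h0
  have hu := hadm.1.deltaJet hT hne hr hntr
  set E := {t ∈ kappaIter T r |
    ¬ DeltaDifferentiableAt (kappaIter T (r - 1)) (iterDeltaDeriv T (r - 1) y) t}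
  set η := variation S r w 0
  have hz := fun ε : ℝ => hu.add_const_mul hv ε
  -- all members of the family are admissible
  have hza : ∀ ε : ℝ, Admissible T r ya yb (fun t => y t + ε * η t) := by
    intro ε
    refine ⟨(hz ε).cprd hT hne hr hnt' hntr, fun i => ?_⟩
    obtain ⟨m, hm⟩ : ∃ m, r - (i : ℕ) = m + 1 := ⟨r - i - 1, by omega⟩
    have heq := (hz ε).iterDeltaDeriv_eqOn hT hne hnt' i.2
    have hva : variation S r w i (sInf T) = 0 := by
      rw [variation, if_pos (le_csSup hS.bddAbove haS), hm, Function.iterate_succ_apply',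
        ← sInf_kappaIter hT hne (r - 1)]
      exact primitive_sInf _ _
    have hvb : variation S r w i (sSup S) = 0 := by
      rw [variation, if_pos le_rfl, hm, h0 m (by omega)]
    constructor
    · rw [← (hadm.2 i).1]
      refine (heq (hSsub i i.2 haS)).trans ?_
      simp only [hva, mul_zero, add_zero]
    · rw [← (hadm.2 i).2, hBρ]
      refine (heq (hSsub i i.2 hBS)).trans ?_
      simp only [hvb, mul_zero, add_zero]
  set H : ℝ → Fin (r + 1) → ℝ := fun t i => (primitive S)^[r - i] w t
  have hjet : ∀ ε : ℝ, ∀ t ∈ kappaIter T r \ (E ∪ F),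
      jet T r (fun t => y t + ε * η t) t = jet T r y t + ε • H t := by
    rintro ε t ht
    have htS : t ∈ S := kappaIter_antitone T (Nat.sub_le r 1) ht.1
    have hvH : ∀ i : Fin (r + 1), variation S r w i t = H t i := fun i => by
      rw [variation, if_pos (le_csSup hS.bddAbove htS)]
    ext i
    simp only [Pi.add_apply, Pi.smul_apply, smul_eq_mul, ← hvH]
    rcases (Nat.lt_succ_iff.1 i.2).lt_or_eq with h | h
    · exact (hz ε).iterDeltaDeriv_eqOn hT hne hnt' h (kappaIter_antitone T h.le ht.1)
    · simp only [jet, h]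
      exact (hz ε).iterDeltaDeriv_top hT hne hr hnt' ht
  have hEF : (E ∪ F).Finite := (hz 0).finite
  have hLine : ∀ ε : ℝ, PrdOn S fun t => L t (jet T r y t + ε • H t) := by
    intro ε
    rw [← prdOn_kappa_iff hS, ← hKr]
    refine ((piecewiseRdContinuous_iff hK hntr).1 (hL_along _ (hza ε))).congr_off_finite hEF
      fun t ht => ?_
    rw [hjet ε t ht]
  have hfun : ∀ ε : ℝ, functional T r L (fun t => y t + ε * η t) =
      primitive S (fun t => L t (jet T r y t + ε • H t)) (sSup S) := by
    intro ε
    obtain ⟨hc, D, hDf, hDσ, hDd⟩ := (hLine ε).isDeltaAntideriv_primitive hS hSne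
    have hanti : IsDeltaAntideriv S (fun t => L t (jet T r (fun t => y t + ε * η t) t))
        (primitive S fun t => L t (jet T r y t + ε • H t)) := by
      refine ⟨hc, D ∪ (E ∪ F), hDf.union hEF, fun t ht => ht.elim (hDσ t) ((hz 0).dense t), ?_⟩
      rintro t ⟨ht, htn⟩
      rw [mem_union, not_or] at htn
      beta_reduce
      rw [hjet ε t ⟨hKr ▸ ht, htn.2⟩]
      exact hDd t ⟨ht, htn.1⟩
    rw [functional, hBρ, deltaIntegral_eq hS hanti haS hBS, ← sInf_kappaIter hT hne (r - 1),
      primitive_sInf, sub_zero]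
  have hηC : Cprd T r η := hv.cprd hT hne hr hnt' hntr
  -- a common bound for the delta derivatives of the variation
  obtain ⟨M, hM⟩ : ∃ M, ∀ i ≤ r, ∀ t ∈ kappaIter T r, |iterDeltaDeriv T i η t| ≤ M := by
    choose M hM using fun i : Fin (r + 1) => (hηC.prdOn_jet hT hne hntr i).exists_bound hK
    refine ⟨∑ i, |M i|, fun i hi t ht => ?_⟩
    exact ((hM ⟨i, Nat.lt_succ_of_le hi⟩ t ht).trans (le_abs_self _)).trans
      (Finset.single_le_sum (f := fun i => |M i|) (fun i _ => abs_nonneg _) (Finset.mem_univ _))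
  have hloc : IsLocalMin (fun ε : ℝ => primitive S (fun t => L t (jet T r y t + ε • H t)) (sSup S))
      0 := by
    have hlim : Tendsto (fun ε : ℝ => ((r : ℝ) + 1) * (|-ε| * M)) (𝓝 0) (𝓝 0) := by
      have : Continuous fun ε : ℝ => ((r : ℝ) + 1) * (|-ε| * M) := by fun_prop
      simpa using this.tendsto 0
    filter_upwards [hlim.eventually_lt_const hδ] with ε hε
    have h1 := hfun 0
    simp only [zero_mul, add_zero] at h1
    rw [← hfun ε, ← h1]
    refine hmin _ (hza ε) ?_
    have h2 : (fun t => y t - (y t + ε * η t)) = fun t => -ε * η t := by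
      ext t
      ring
    rw [h2]
    exact (weakNorm_const_mul_le hT hne hnt' hM (-ε)).trans_lt
      ((ENNReal.ofReal_lt_ofReal_iff hδ).2 hε)
  have hLS : HasContinuousPartials (kappa S) L := hKr ▸ hL
  refine hloc.hasDerivAt_eq_zero (hasDerivAt_primitive_line hS hSne hLS
    (fun i => (prdOn_kappa_iff hS).1 (hKr ▸ hadm.1.prdOn_jet hT hne hntr i)) (fun i => ?_) hLine)
  exact hw.iterate_primitive hS hSne _

/-- The part of the Euler–Lagrange expression that does not involve the constants of integration. -/
def eulerLagrangeFree (T : Set ℝ) (r : ℕ) (L : ℝ → (Fin (r + 1) → ℝ) → ℝ) (y : ℝ → ℝ)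
    (t : ℝ) : ℝ :=
  ∑ k ∈ Finset.range (r + 1), (-1) ^ k * iterIntegral (kappaIter T (r - 1))
    (partialAlong T r L y ⟨r - k, Nat.lt_succ_of_le (Nat.sub_le r k)⟩) k t

/-- With suitable constants, the Euler–Lagrange expression is its constant-free part minus an
arbitrary linear combination of the iterated integrals of `1`. -/
lemma eulerLagrange_eq {T : Set ℝ} {r : ℕ} (hr : 1 ≤ r) (hS : IsCompact (kappaIter T (r - 1)))
    (hne : (kappaIter T (r - 1)).Nonempty) {L : ℝ → (Fin (r + 1) → ℝ) → ℝ} {y : ℝ → ℝ}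
    (hf : PrdOn (kappaIter T (r - 1)) (partialAlong T r L y 0)) (d : ℕ → ℝ) (t : ℝ) :
    eulerLagrange T r L y (fun m => (-1) ^ r * (-1) ^ m * d (r - m)) t =
      eulerLagrangeFree T r L y t -
        ∑ j ∈ Finset.range r, d j * iterIntegral (kappaIter T (r - 1)) (fun _ => 1) j t := by
  have hsign : ∀ m : ℕ, ((-1 : ℝ) ^ m) * (-1) ^ m = 1 := fun m => by
    rw [← mul_pow]
    norm_num
  have hlast : (⟨r - r, Nat.lt_succ_of_le (Nat.sub_le r r)⟩ : Fin (r + 1)) = 0 := by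
    ext
    simp
  have hconst : (-1) ^ r * ∑ j ∈ Finset.range r, (-1 : ℝ) ^ (r - j) *
      ((-1) ^ r * (-1) ^ (r - j) * d (r - (r - j))) *
        iterIntegral (kappaIter T (r - 1)) (fun _ => 1) j t =
      ∑ j ∈ Finset.range r, d j * iterIntegral (kappaIter T (r - 1)) (fun _ => 1) j t := by
    rw [Finset.mul_sum]
    refine Finset.sum_congr rfl fun j hj => ?_
    rw [Nat.sub_sub_self (Finset.mem_range.1 hj).le]
    calc _ = ((-1 : ℝ) ^ r * (-1) ^ r) * ((-1) ^ (r - j) * (-1) ^ (r - j)) *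
          (d j * iterIntegral (kappaIter T (r - 1)) (fun _ => 1) j t) := by ring
      _ = _ := by rw [hsign, hsign, one_mul, one_mul]
  rw [eulerLagrange, eulerLagrangeFree, hf.iterIntegralConst_eq hS hne, mul_sub, hconst,
    Finset.sum_range_succ, hlast]
  have h0 : (-1 : ℝ) ^ 0 * iterIntegral (kappaIter T (r - 1))
      (partialAlong T r L y ⟨r - 0, Nat.lt_succ_of_le (Nat.sub_le r 0)⟩) 0 t =
      partialAlong T r L y (Fin.last r) t := by
    rw [pow_zero, one_mul]
    rfl
  have hsplit := Finset.sum_eq_sum_Ico_succ_bot (by omega : 0 < r) fun k =>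
    (-1 : ℝ) ^ k * iterIntegral (kappaIter T (r - 1))
      (partialAlong T r L y ⟨r - k, Nat.lt_succ_of_le (Nat.sub_le r k)⟩) k t
  rw [h0, ← Finset.range_eq_Ico] at hsplit
  rw [hsplit]
  ring

/-- The weak form of the Euler–Lagrange equation, after repeated integration by parts. -/
lemma IsWeakLocalMinimizer.primitive_eulerLagrangeFree_mul {T : Set ℝ} (hT : IsCompact T)
    (hne : T.Nonempty) {r : ℕ} (hr : 1 ≤ r) (hnt : ∀ i ≤ r, (kappaIter T i).Nontrivial)
    {L : ℝ → (Fin (r + 1) → ℝ) → ℝ} {ya yb : Fin r → ℝ}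
    (hL : HasContinuousPartials (kappaIter T r) L)
    (hL_along : ∀ z : ℝ → ℝ, Admissible T r ya yb z →
      PiecewiseRdContinuous (kappaIter T r) (fun t => L t (jet T r z t)))
    {y : ℝ → ℝ} (hy : IsWeakLocalMinimizer T r L ya yb y)
    (hf : ∀ i, PrdOn (kappaIter T (r - 1)) (partialAlong T r L y i)) {w : ℝ → ℝ}
    (hw : PrdOn (kappaIter T (r - 1)) w)
    (h0 : ∀ i < r, (primitive (kappaIter T (r - 1)))^[i + 1] w (sSup (kappaIter T (r - 1))) = 0) :
    primitive (kappaIter T (r - 1)) (fun t => eulerLagrangeFree T r L y t * w t)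
      (sSup (kappaIter T (r - 1))) = 0 := by
  have hvar := hy.primitive_eq_zero hT hne hr hnt hL hL_along hw h0
  set S := kappaIter T (r - 1) with hSdef
  have hS : IsCompact S := isCompact_kappaIter hT hne _
  have hSne : S.Nonempty := (hnt (r - 1) (by omega)).nonempty
  rw [PrdOn.primitive_sum hS hSne _ fun i _ => (hf i).mul (hw.iterate_primitive hS hSne _),
    ← Equiv.sum_comp Fin.revPerm] at hvar
  have hterm : ∀ k ∈ Finset.range (r + 1), PrdOn S fun t => (-1) ^ k *
      (iterIntegral S (partialAlong T r L y ⟨r - k, Nat.lt_succ_of_le (Nat.sub_le r k)⟩) k t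
        * w t) := fun k _ => (((hf _).iterIntegral hS hSne k).mul hw).const_mul _
  have hfun : (fun t => eulerLagrangeFree T r L y t * w t) = fun t =>
      ∑ k ∈ Finset.range (r + 1), (-1) ^ k *
        (iterIntegral S (partialAlong T r L y ⟨r - k, Nat.lt_succ_of_le (Nat.sub_le r k)⟩) k t
          * w t) := by
    ext t
    rw [eulerLagrangeFree, Finset.sum_mul]
    exact Finset.sum_congr rfl fun k _ => mul_assoc _ _ _
  rw [hfun, PrdOn.primitive_sum hS hSne _ hterm, Finset.sum_range, ← hvar]
  refine Finset.sum_congr rfl fun k _ => ?_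
  have hk : (k : ℕ) ≤ r := Nat.lt_succ_iff.1 k.2
  have hrev : Fin.revPerm k = ⟨r - k, Nat.lt_succ_of_le (Nat.sub_le r k)⟩ := by
    ext
    simp [Fin.val_rev]
  have hparts := (hf ⟨r - k, Nat.lt_succ_of_le (Nat.sub_le r k)⟩).primitive_mul_iterate hS hSne hw
    k 0 fun i hi => h0 i (hi.trans_le hk)
  rw [zero_add] at hparts
  rw [hrev, primitive_const_mul, ← hparts]
  simp only [Nat.sub_sub_self hk]
  rfl

/-- At points where `y^{Δ^r}` exists and which are right-dense, the top derivative is continuous. -/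
lemma Cprd.continuousWithinAt_top {T : Set ℝ} (hT : IsCompact T) (hne : T.Nonempty) {r : ℕ}
    (hr : 1 ≤ r) (hnt : ∀ i ≤ r, (kappaIter T i).Nontrivial) {y : ℝ → ℝ} (hy : Cprd T r y) {t : ℝ}
    (ht : t ∈ kappaIter T r) (hσ : sigma (kappaIter T (r - 1)) t = t)
    (hd : DeltaDifferentiableAt (kappaIter T (r - 1)) (iterDeltaDeriv T (r - 1) y) t) :
    ContinuousWithinAt (iterDeltaDeriv T r y) (kappaIter T (r - 1)) t := by
  have hu := hy.deltaJet hT hne hr (hnt r le_rfl).nonempty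
  obtain ⟨k, rfl⟩ : ∃ k, r = k + 1 := ⟨r - 1, by omega⟩
  rw [Nat.add_sub_cancel] at *
  set S := kappaIter T k with hSdef
  have hS : IsCompact S := isCompact_kappaIter hT hne _
  have hSne : S.Nonempty := (hnt k (by omega)).nonempty
  have htS : t ∈ S := kappaIter_antitone T (Nat.le_succ k) ht
  have hprd : PrdOn S (iterDeltaDeriv T (k + 1) y) := by
    rw [← prdOn_kappa_iff hS, hSdef, ← kappaIter_succ]
    exact hu.prd
  have hanti : IsDeltaAntideriv S (iterDeltaDeriv T (k + 1) y) (iterDeltaDeriv T k y) := by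
    refine ⟨hy.continuousOn k (Nat.lt_succ_self k), _, hu.finite, hu.dense, ?_⟩
    rw [hSdef, ← kappaIter_succ]
    exact hu.top
  refine hprd.continuousWithinAt_of_hasDeltaDerivAt hS htS hσ ?_
  have hsub : EqOn (fun s => iterDeltaDeriv T k y s + -1 * iterDeltaDeriv T k y t +
      primitive S (iterDeltaDeriv T (k + 1) y) t) (primitive S (iterDeltaDeriv T (k + 1) y)) S := by
    intro s hs
    have := hanti.sub_eq_sub hS (hprd.isDeltaAntideriv_primitive hS hSne) htS hs
    simp only
    linarith
  refine HasDeltaDerivAt.congr (sigma_mem hS hSne t) hsub ?_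
  have hder := hd.hasDeltaDerivAt
  rw [hasDeltaDerivAt_iff_of_sigma_eq hσ] at hder ⊢
  exact (hder.add_const _).add_const _

end TimeScale

end

open TimeScale in
theorem mainTheorem1 (T : Set ℝ) (hT_closed : IsClosed T) (hT_bounded : Bornology.IsBounded T)
    (r : ℕ) (hr : 1 ≤ r) (hT_card : ((2 * r + 1 : ℕ) : ℕ∞) ≤ T.encard)
    (L : ℝ → (Fin (r + 1) → ℝ) → ℝ) (ya yb : Fin r → ℝ)
    (hL_partials : TimeScale.HasContinuousPartials (TimeScale.kappaIter T r) L)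
    (hL_along : ∀ z : ℝ → ℝ, TimeScale.Admissible T r ya yb z →
      TimeScale.PiecewiseRdContinuous (TimeScale.kappaIter T r)
        (fun t => L t (TimeScale.jet T r z t)))
    (y : ℝ → ℝ) (hy : TimeScale.IsWeakLocalMinimizer T r L ya yb y) :
    ∃ c : ℕ → ℝ, ∀ t ∈ TimeScale.kappaIter T r,
      TimeScale.DeltaDifferentiableAt (TimeScale.kappaIter T (r - 1))
        (TimeScale.iterDeltaDeriv T (r - 1) y) t →
      TimeScale.eulerLagrange T r L y c t = 0 := by
  have hT : IsCompact T := Metric.isCompact_of_isClosed_isBounded hT_closed hT_bounded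
  have hne : T.Nonempty := by
    rw [← encard_ne_zero]
    intro h
    rw [h] at hT_card
    have := Nat.cast_le.1 (hT_card.trans_eq Nat.cast_zero.symm)
    omega
  have hnt : ∀ i ≤ r, (kappaIter T i).Nontrivial := fun i hi =>
    nontrivial_kappaIter hT hne ((Nat.cast_le.2 (by omega)).trans hT_card)
  have hyC := hy.1.1
  set S := kappaIter T (r - 1) with hSdef
  have hS : IsCompact S := isCompact_kappaIter hT hne _
  have hSnt : S.Nontrivial := hnt (r - 1) (by omega)
  have hSne := hSnt.nonempty
  have hKr : kappaIter T r = kappa S := by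
    rw [hSdef, ← kappaIter_succ, Nat.sub_add_cancel hr]
  have hf : ∀ i, PrdOn S (partialAlong T r L y i) := fun i => by
    rw [← prdOn_kappa_iff hS, ← hKr]
    exact PrdOn.comp (hL_partials i).2 fun j => hyC.prdOn_jet hT hne (hnt r le_rfl).nonempty j
  have hone : PrdOn S fun _ => (1 : ℝ) := .const 1
  have hG : PrdOn S (eulerLagrangeFree T r L y) := PrdOn.sum _ fun k _ =>
    ((hf _).iterIntegral hS hSne k).const_mul _
  -- `w` below is the constant-free part minus its projection to the span of the iterated
  -- integrals of `1`, hence itself the top derivative of a variation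
  obtain ⟨d, hd⟩ := exists_orthogonal hS hSne (p := fun j : Fin r => iterIntegral S (fun _ => 1) j)
    (fun j => hone.iterIntegral hS hSne j) hG
  obtain ⟨e, he⟩ : ∃ e : ℕ → ℝ, ∀ j : Fin r, e j = d j :=
    ⟨fun j => if h : j < r then d ⟨j, h⟩ else 0, fun j => by simp⟩
  have hsum : ∀ t, ∑ j : Fin r, d j * iterIntegral S (fun _ => 1) j t =
      ∑ j ∈ Finset.range r, e j * iterIntegral S (fun _ => 1) j t := fun t => by
    rw [Finset.sum_range]
    exact Finset.sum_congr rfl fun j _ => by rw [he]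
  simp only [hsum] at hd
  set w : ℝ → ℝ := fun t => eulerLagrangeFree T r L y t -
    ∑ j ∈ Finset.range r, e j * iterIntegral S (fun _ => 1) j t with hwdef
  have hpterm : ∀ j ∈ Finset.range r, PrdOn S fun t => e j * iterIntegral S (fun _ => 1) j t :=
    fun j _ => (hone.iterIntegral hS hSne j).const_mul _
  have hw : PrdOn S w := hG.sub (PrdOn.sum _ hpterm)
  have horth : ∀ j < r, primitive S (fun t => iterIntegral S (fun _ => 1) j t * w t) (sSup S) = 0 :=
    fun j hj => hd ⟨j, hj⟩
  have h0 : ∀ i < r, (primitive S)^[i + 1] w (sSup S) = 0 := fun i hi =>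
    hw.iterate_primitive_sSup hS hSne horth hi
  have hGw := hy.primitive_eulerLagrangeFree_mul hT hne hr hnt hL_partials hL_along hf hw h0
  have hsq : primitive S (fun t => w t * w t) (sSup S) = 0 := by
    have hterm : ∀ j ∈ Finset.range r, PrdOn S fun t =>
        e j * (iterIntegral S (fun _ => 1) j t * w t) :=
      fun j _ => ((hone.iterIntegral hS hSne j).mul hw).const_mul _
    have hfun : (fun t => w t * w t) = fun t => eulerLagrangeFree T r L y t * w t -
        ∑ j ∈ Finset.range r, e j * (iterIntegral S (fun _ => 1) j t * w t) := by
      ext t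
      conv_lhs => rw [hwdef]
      simp only
      rw [sub_mul, Finset.sum_mul]
      congr 1
      exact Finset.sum_congr rfl fun j _ => mul_assoc _ _ _
    rw [hfun, (hG.mul hw).primitive_fun_sub hS hSne (PrdOn.sum _ hterm),
      PrdOn.primitive_sum hS hSne _ hterm, hGw, zero_sub, neg_eq_zero]
    refine Finset.sum_eq_zero fun j hj => ?_
    rw [primitive_const_mul, horth j (Finset.mem_range.1 hj), mul_zero]
  refine ⟨fun m => (-1) ^ r * (-1) ^ m * e (r - m), fun t ht hdiff => ?_⟩
  rw [eulerLagrange_eq hr hS hSne (hf 0)]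
  refine hw.eq_zero_of_primitive_sq hS hSnt hsq (hKr ▸ ht) fun hσ => ?_
  -- continuity of `w` at a right-dense point at which `y^{Δ^r}` exists
  have htS : t ∈ S := kappaIter_antitone T (Nat.sub_le r 1) ht
  have hiter : ∀ {f : ℝ → ℝ}, PrdOn S f → ∀ k, (k = 0 → ContinuousWithinAt f S t) →
      ContinuousWithinAt (iterIntegral S f k) S t := by
    intro f hf k hk
    cases k with
    | zero => exact hk rfl
    | succ k =>
      rw [funext (hf.iterIntegral_succ hS hSne k)]
      exact continuousWithinAt_comp_sigma hS hSne
        ((hf.iterIntegral hS hSne k).continuous_primitive hS hSne).continuousOn htS hσ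
  have hjet : ContinuousWithinAt (jet T r y) S t := by
    refine continuousWithinAt_pi.2 fun i => ?_
    rcases (Nat.lt_succ_iff.1 i.2).lt_or_eq with h | h
    · have hsub : S ⊆ kappaIter T i := kappaIter_antitone T (by omega)
      exact (hyC.continuousOn i h t (hsub htS)).mono hsub
    · simp only [jet, h]
      exact hyC.continuousWithinAt_top hT hne hr hnt ht hσ hdiff
  have hpart : ∀ i, ContinuousWithinAt (partialAlong T r L y i) S t := by
    intro i
    have hnhds : 𝓝[kappaIter T r] t = 𝓝[S] t := by
      rw [hKr]
      exact nhdsWithin_kappa_eq hS (hKr ▸ ht)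
    rw [ContinuousWithinAt, ← hnhds] at hjet ⊢
    have hpair : Tendsto (fun s => (s, jet T r y s)) (𝓝[kappaIter T r] t)
        (𝓝[kappaIter T r ×ˢ univ] (t, jet T r y t)) := by
      refine tendsto_nhdsWithin_iff.2 ⟨Tendsto.prodMk_nhds nhdsWithin_le_nhds hjet, ?_⟩
      filter_upwards [self_mem_nhdsWithin] with s hs using ⟨hs, mem_univ _⟩
    exact ((hL_partials i).2 (t, jet T r y t) ⟨ht, mem_univ _⟩).tendsto.comp hpair
  refine ContinuousWithinAt.sub ?_ ?_
  · refine tendsto_finsetSum _ fun k _ => ?_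
    exact continuousWithinAt_const.mul (hiter (hf _) k fun _ => hpart _)
  · refine tendsto_finsetSum _ fun j _ => ?_
    exact continuousWithinAt_const.mul (hiter hone j fun _ => continuousWithinAt_const)
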